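/- **Setting.** Let $1\le m\le n$ and let $f_1,\dots,f_n:\mathbb R^d\to\mathbb R$ be differentiable, $f=\frac1n\sum_{i=1}^n f_i$ bounded below, $h_i=f-f_i$. Assume that there are $\Delta_1,\delta,L_1>0$ with, for all $x,y\in\mathbb R^d$, $$\|\nabla h_1(x)-\nabla h_1(y)\|\le\Delta_1\|x-y\|,\quad \frac1n\sum_{i=1}^n\|\nabla h_i(x)-\nabla h_i(y)\|^2\le\delta^2\|x-y\|^2,\quad \|\nabla f_1(x)-\nabla f_1(y)\|\le L_1\|x-y\|.$$ Put $n_m=n/m$ and $\delta_m=\delta\sqrt{\frac{n-m}{m(n-1)}}$ ($\delta_m=0$ if $n=1$). Let $x^0\in\mathbb R^d$ with $F^0:=f(x^0)-\inf f>0$, let $\varepsilon>0$ and $p_B\in(0,1]$. **Method (I-CGM-RG-SVRG).** Let $\hat K_t$ be geometric, $P(\hat K_t=k)=(1-p)^kp$ for $k\ge0$, let $S_t$ be uniform on the $m$-element subsets of $\{1,\dots,n\}$, let $\omega_t$ be Bernoulli with parameter $p_B$, and let $\tau$ be uniform on $\{1,\dots,T\}$; all these variables are mutually independent. Write $f_S=\frac1m\sum_{i\in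 S}f_i$. Start with $w^0=x^0$, $g^0=\nabla f(x^0)$. Iteration $t=0,\dots,T-1$ does the following. 1. $x^{t+1}=y^t_{\hat K_t+1}$, where $y^t_0=x^t$ and $y^t_{k+1}=\frac1{\lambda+L_1}\bigl(L_1y^t_k+\lambda x^t+\nabla f_1(x^t)-g^t-\nabla f_1(y^t_k)\bigr)$. 2. $g^{t+1}=(1-\beta)g^t+\beta G^t+\nabla f_{S_t}(x^{t+1})-\nabla f_{S_t}(x^t)$ with $G^t=\nabla f_{S_t}(x^t)+\nabla f(w^t)-\nabla f_{S_t}(w^t)$ (so $G^0=\nabla f(x^0)$). 3. $w^{t+1}=x^{t+1}$ if $\omega_{t+1}=1$, and $w^{t+1}=w^t$ otherwise. The output is $\bar x^T=x^\tau$. **Costs.** The server and the clients interact in communication rounds, and client $i$ accesses $f_i$ only through queries of its first-order oracle $x\mapsto(f_i(x),\nabla f_i(x))$. A round uses arbitrary client selection (at most $m$ clients, chosen by the server), random client selection ($m$ clients drawn uniformly) or delegated selection (client 1 only). The full gradients $\nabla f(x^0)$ and, whenever $\omega_{t+1}=1$, $\nabla f(w^{t+1})$ are computed in $\lceil n_m\rceil$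 rounds of arbitrary selection. Step 2 uses one round of random selection, in which each client of $S_t$ makes the 3 queries at $x^{t+1},x^t,w^t$. Step 1 uses one delegated round with $\hat K_t+1$ queries. If $N_A,N_R,N_D$ are the numbers of rounds of the three kinds, the communication complexity is $\mathbb E[C_AN_A+C_RN_R+N_D]$, where $1\le C_R\le C_A$. The local complexity is the expectation of the sum over all rounds of the maximal number of oracle queries made by a client in the round. **Theorem.** Let $\lambda=3\Delta_1+22\delta_m/\sqrt{p_B}$, $\beta=p_B/2$, $p=\frac{\lambda-\Delta_1}{8(L_1+\lambda)}$ and $T=\Bigl\lceil\frac{256(\Delta_1+8\delta_m/\sqrt{p_B})F^0}{\varepsilon^2}\Bigr\rceil$. Then $$\mathbb E\|\nabla f(\bar x^T)\|^2\le\varepsilon^2 .$$ If moreover $p_B=\frac{C_R}{C_A\lceil n_m\rceil}$, then the communication complexity is at most $$C_A\lceil n_m\rceil+(2C_R+1)\left\lceil\frac{256\bigl(\Delta_1+8\delta_m\sqrt{C_A\lceil n_m\rceil/C_R}\bigr)F^0}{\varepsilon^2}\right\rceil,$$ and the local complexity is at most $$16+\lceil n_m\rceil+\frac{1024\bigl(L_1+4\Delta_1+33\sqrt{C_A\lceil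 n_m\rceil/C_R}\,\delta_m\bigr)F^0}{\varepsilon^2}+\frac{4L_1}{\Delta_1+11\sqrt{C_A\lceil n_m\rceil/C_R}\,\delta_m}.$$ All these expectations are finite. -/

import Mathlib

open MeasureTheory ProbabilityTheory

namespace FedOpt

noncomputable section

/-! ### The federated optimization model -/

/-- A local method of a client whose oracle is a first-order oracle on `E`: it either stops with a
result, or queries the oracle at a point and goes on according to the answer (value, gradient). -/
inductive LocalMethod (E R : Type) : Type where
  | halt (r : R) : LocalMethod E R
  | query (x : E) (next : ℝ × E → LocalMethod E R) : LocalMethod E R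

/-- The result of a local method when the oracle is `O`. -/
def LocalMethod.result {E R : Type} (O : E → ℝ × E) : LocalMethod E R → R
  | .halt r => r
  | .query x next => (next (O x)).result O

/-- The number of oracle queries that a local method makes when the oracle is `O`. -/
def LocalMethod.queries {E R : Type} (O : E → ℝ × E) : LocalMethod E R → ℕ
  | .halt _ => 0
  | .query x next => (next (O x)).queries O + 1

/-- The client-selection strategies: arbitrary, random, delegated. -/
inductive Strategy : Type where
  | ass
  | rss
  | dss
  deriving DecidableEq

/-- A federated algorithm for `n` clients of which at most `m` communicate in one round: either it
stops with an output, or it performs a communication round, by one of the three strategies, in which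
every selected client runs a local method and sends its result back to the server, which goes on
according to the received results.
With `ass` the server chooses the set of clients, with `rss` the set is drawn by the environment,
with `dss` the only client is the delegate client. -/
inductive FedAlgorithm (n m : ℕ) (E A : Type) : Type 1 where
  | halt (a : A) : FedAlgorithm n m E A
  | ass {R : Type} (S : Finset (Fin n)) (hS : S.card ≤ m) (method : Fin n → LocalMethod E R)
      (next : ({i // i ∈ S} → R) → FedAlgorithm n m E A) : FedAlgorithm n m E A
  | rss {R : Type} (method : Fin n → LocalMethod E R)
      (next : (S : Finset (Fin n)) → ({i // i ∈ S} → R) → FedAlgorithm n m E A) :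
      FedAlgorithm n m E A
  | dss {R : Type} (method : LocalMethod E R)
      (next : R → FedAlgorithm n m E A) : FedAlgorithm n m E A

/-- What is counted in a communication round: the strategy that was used, and the maximal number of
oracle queries made by a selected client. -/
structure Round : Type where
  strategy : Strategy
  localCost : ℕ

section Run

variable {n m : ℕ} [NeZero n] {E A : Type}

/-- The output of an algorithm when client `i` has the oracle `O i` and the successive uses of `rss`
draw the sets `S 0, S 1, …`. The delegate client is the first one, `0 : Fin n`. -/
def FedAlgorithm.output (O : Fin n → E → ℝ × E) :
    FedAlgorithm n m E A → (ℕ → Finset (Fin n)) → A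
  | .halt a, _ => a
  | .ass _ _ method next, S => (next fun i => (method i).result (O i)).output O S
  | .rss method next, S =>
      (next (S 0) fun i => (method i).result (O i)).output O (fun j => S (j + 1))
  | .dss method next, S => (next (method.result (O 0))).output O S

/-- The list of the communication rounds performed by an algorithm. -/
def FedAlgorithm.rounds (O : Fin n → E → ℝ × E) :
    FedAlgorithm n m E A → (ℕ → Finset (Fin n)) → List Round
  | .halt _, _ => []
  | .ass C _ method next, S =>
      ⟨.ass, C.sup fun i => (method i).queries (O i)⟩ ::
        (next fun i => (method i).result (O i)).rounds O S
  | .rss method next, S =>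
      ⟨.rss, (S 0).sup fun i => (method i).queries (O i)⟩ ::
        (next (S 0) fun i => (method i).result (O i)).rounds O (fun j => S (j + 1))
  | .dss method next, S =>
      ⟨.dss, method.queries (O 0)⟩ :: (next (method.result (O 0))).rounds O S

end Run

/-- The number of rounds in which a given strategy was used. -/
def numUses (s : Strategy) (l : List Round) : ℕ := (l.map Round.strategy).count s

/-- The cost `C_A N_A + C_R N_R + N_D` of a list of communication rounds. -/
def communicationCost (C_A C_R : ℝ) (l : List Round) : ℝ :=
  C_A * numUses .ass l + C_R * numUses .rss l + numUses .dss l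

/-- The total local cost of a list of communication rounds. -/
def localCost (l : List Round) : ℕ := (l.map Round.localCost).sum

/-! ### The optimization problem -/

section Problem

variable {n d : ℕ}

/-- The objective `f = (1/n) ∑ f_i`. -/
def objective (f : Fin n → EuclideanSpace ℝ (Fin d) → ℝ) (x : EuclideanSpace ℝ (Fin d)) : ℝ :=
  (1 / (n : ℝ)) * ∑ i, f i x

/-- The difference function `h_i = f - f_i`. -/
def difference (f : Fin n → EuclideanSpace ℝ (Fin d) → ℝ) (i : Fin n)
    (x : EuclideanSpace ℝ (Fin d)) : ℝ :=
  objective f x - f i x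

/-- `F⁰ = f(x⁰) - inf f`. -/
def initialGap (f : Fin n → EuclideanSpace ℝ (Fin d) → ℝ) (x₀ : EuclideanSpace ℝ (Fin d)) : ℝ :=
  objective f x₀ - ⨅ x, objective f x

/-- The first-order oracles of the clients. -/
def firstOrderOracle (f : Fin n → EuclideanSpace ℝ (Fin d) → ℝ) (i : Fin n)
    (x : EuclideanSpace ℝ (Fin d)) : ℝ × EuclideanSpace ℝ (Fin d) :=
  (f i x, gradient (f i) x)

end Problem

/-- `δ_m`, given by `δ_m² = (q_m / m) δ²` with `q_m = (n - m) / (n - 1)`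
(which for `n = m = 1` is read as `0`). -/
def deltaM (n m : ℕ) (δ : ℝ) : ℝ :=
  Real.sqrt ((((n : ℝ) - m) / ((n : ℝ) - 1)) / m) * δ

/-! ### The method I-CGM-RG-SVRG -/

section Method

variable {n m : ℕ} {E : Type} [NormedAddCommGroup E] [InnerProductSpace ℝ E]

/-- One step of the local composite gradient method for the subproblem at `x` with gradient estimate
`g`: here `c = ∇f₁(x)`, `y` is the current point and `gy = ∇f₁(y)`. The new point is the minimizer of
`⟪gy, z - y⟫ + (L/2) ‖z - y‖² + ⟪g - c, z - x⟫ + (lam/2) ‖z - x‖²` in `z`. -/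
def cgmStep (L lam : ℝ) (x g c y gy : E) : E :=
  (1 / (lam + L)) • (L • y + lam • x + c - g - gy)

/-- `k` steps of the local composite gradient method from `y`. -/
def cgmSteps (L lam : ℝ) (x g c : E) : ℕ → E → LocalMethod E E
  | 0, y => .halt y
  | k + 1, y => .query y fun o => cgmSteps L lam x g c k (cgmStep L lam x g c y o.2)

/-- `CGM_rand(lam, k, x, g)`: `k + 1` steps of the local composite gradient method from `x`. The
gradient at `x` occurs twice in the first step, and is queried once. -/
def cgm (L lam : ℝ) (k : ℕ) (x g : E) : LocalMethod E E :=
  .query x fun o => cgmSteps L lam x g o.2 k (cgmStep L lam x g o.2 x o.2)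

/-- The clients with indices `j m, …, j m + m - 1`. -/
def block (n m j : ℕ) : Finset (Fin n) :=
  Finset.univ.filter fun i => j * m ≤ (i : ℕ) ∧ (i : ℕ) < j * m + m

theorem card_block_le (n m j : ℕ) : (block n m j).card ≤ m := by
  have h : (block n m j).map Fin.valEmbedding ⊆ Finset.Ico (j * m) (j * m + m) := by
    intro a ha
    simp only [Finset.mem_map, block, Finset.mem_filter] at ha
    obtain ⟨i, ⟨-, hi⟩, rfl⟩ := ha
    simpa using hi
  simpa using Finset.card_le_card h

/-- Collects the gradients at `x` of the clients of the blocks `0, …, j - 1`, one block per use of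
arbitrary client selection, and adds the sum of these gradients, divided by `n`, to `acc`. -/
def collectGradients {A : Type} (x : E) (next : E → FedAlgorithm n m E A) :
    ℕ → E → FedAlgorithm n m E A
  | 0, acc => next acc
  | j + 1, acc =>
      .ass (block n m j) (card_block_le n m j) (fun _ => .query x fun o => .halt o.2)
        fun r => collectGradients x next j (acc + (1 / (n : ℝ)) • ∑ i, r i)

/-- Full synchronization: the server computes `∇f(x)` in `⌈n / m⌉` rounds with arbitrary client
selection. -/
def fullSync {A : Type} (x : E) (next : E → FedAlgorithm n m E A) : FedAlgorithm n m E A :=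
  collectGradients x next ⌈(n : ℝ) / m⌉₊ 0

/-- The RG-SVRG update. For a client `i` in the random set `S = S_t`, `r i` is
`(∇f_i(xᵗ⁺¹), ∇f_i(xᵗ), ∇f_i(wᵗ))`; further `g = gᵗ` and `gw = ∇f(wᵗ)`. The result is
`gᵗ⁺¹ = (1 - β) gᵗ + β Gᵗ + ∇f_S(xᵗ⁺¹) - ∇f_S(xᵗ)`,
where `Gᵗ = ∇f_S(xᵗ) + ∇f(wᵗ) - ∇f_S(wᵗ)` is the SVRG estimator (equal to `∇f(x⁰)` for `t = 0`,
because `w⁰ = x⁰`). -/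
def rgSvrgUpdate (m : ℕ) (β : ℝ) (g gw : E) (S : Finset (Fin n))
    (r : {i // i ∈ S} → E × E × E) : E :=
  let new := (1 / (m : ℝ)) • ∑ i, (r i).1
  let old := (1 / (m : ℝ)) • ∑ i, (r i).2.1
  let ref := (1 / (m : ℝ)) • ∑ i, (r i).2.2
  (1 - β) • g + β • (old + gw - ref) + new - old

/-- The iterations `t, t + 1, …` of I-CGM-RG-SVRG; the first explicit number is the number of
iterations still to be done, `x = xᵗ`, `g = gᵗ`, `w = wᵗ`, `gw = ∇f(wᵗ)`, and `hist s = xˢ` for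
`s ≤ t`. Iteration `t` computes `xᵗ⁺¹` (delegate client, `K t + 1` local steps), then `gᵗ⁺¹` (random
clients `S_t`), then `wᵗ⁺¹`, which is `xᵗ⁺¹` if `coin (t + 1)` shows `true` (and then the server
computes `∇f(wᵗ⁺¹)` by a full synchronization) and `wᵗ` otherwise. The output is `x^τ`. -/
def icgmLoop (L lam β : ℝ) (K : ℕ → ℕ) (coin : ℕ → Bool) (τ : ℕ) :
    ℕ → ℕ → E → E → E → E → (ℕ → E) → FedAlgorithm n m E E
  | 0, _, _, _, _, _, hist => .halt (hist τ)
  | r + 1, t, x, g, w, gw, hist =>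
      .dss (cgm L lam (K t) x g) fun x' =>
        .rss (fun _ => .query x' fun o₁ => .query x fun o₂ => .query w fun o₃ =>
            .halt (o₁.2, o₂.2, o₃.2)) fun S a =>
          let g' := rgSvrgUpdate m β g gw S a
          let hist' := Function.update hist (t + 1) x'
          if coin (t + 1) then
            fullSync x' fun gx' => icgmLoop L lam β K coin τ r (t + 1) x' g' x' gx' hist'
          else
            icgmLoop L lam β K coin τ r (t + 1) x' g' w gw hist'

/-- `T` iterations of I-CGM-RG-SVRG from `x₀`, with `w⁰ = x⁰` and `g⁰ = ∇f(x⁰)`, for given values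
`K t` of the geometric variables, `coin t` of the Bernoulli variables, and `τ` of the index of the
iterate that is returned. -/
def icgmRgSvrg (n m : ℕ) (L lam β : ℝ) (T : ℕ) (x₀ : E) (K : ℕ → ℕ) (coin : ℕ → Bool) (τ : ℕ) :
    FedAlgorithm n m E E :=
  fullSync x₀ fun g₀ => icgmLoop L lam β K coin τ T 0 x₀ g₀ x₀ g₀ fun _ => x₀

end Method

/-- The randomness of the method: the `K t` are geometric, `P(K t = k) = (1 - p)^k p`, the `S t` are
uniform on the `m`-element subsets of the set of clients, the `coin t` are Bernoulli with parameter
`pB`, `τ` is uniform on `{1, …, T}`, and all these random variables together are mutually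
independent. -/
structure IsRandomness {Ω : Type*} [mΩ : MeasurableSpace Ω] (μ : Measure Ω) (n m T : ℕ) (p pB : ℝ)
    (K : ℕ → Ω → ℕ) (S : ℕ → Ω → Finset (Fin n)) (coin : ℕ → Ω → Bool) (τ : Ω → ℕ) : Prop where
  measurable_K : ∀ t, Measurable[mΩ, ⊤] (K t)
  measurable_S : ∀ t, Measurable[mΩ, ⊤] (S t)
  measurable_coin : ∀ t, Measurable[mΩ, ⊤] (coin t)
  measurable_τ : Measurable[mΩ, ⊤] τ
  law_K : ∀ t k, μ {ω | K t ω = k} = ENNReal.ofReal ((1 - p) ^ k * p)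
  law_S : ∀ t, ∀ C : Finset (Fin n), C.card = m →
    μ {ω | S t ω = C} = ENNReal.ofReal (1 / (n.choose m : ℝ))
  law_coin : ∀ t, μ {ω | coin t ω = true} = ENNReal.ofReal pB
  law_τ : ∀ j ∈ Finset.Icc 1 T, μ {ω | τ ω = j} = ENNReal.ofReal (1 / (T : ℝ))
  indep : iIndep
    (Sum.elim (fun t : ℕ => MeasurableSpace.comap (K t) ⊤)
      (Sum.elim (fun t : ℕ => MeasurableSpace.comap (S t) ⊤)
        (Sum.elim (fun t : ℕ => MeasurableSpace.comap (coin t) ⊤)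
          (fun _ : Unit => MeasurableSpace.comap τ ⊤)))) μ

end

end FedOpt

open FedOpt

/-! Write F = ∇f, a = λ − Δ₁, e = ‖F(xᵗ) − gᵗ‖², d = ‖xᵗ − wᵗ‖², r = ‖xᵗ⁺¹ − xᵗ‖², D = δ_m². The
local method works on `cgmModel`: up to a constant this is f with h₁ linearised at xᵗ, the slope of
h₁ estimated through gᵗ, and a proximal term added. A local step lowers the model by (L₁ + λ)/2
times its squared length and leaves a model gradient of at most 2L₁ times its length. So the
gradient left at the returned point is paid for by the decrease in the last step alone. For a
geometric number of steps the expected last decrease is p times the expected total decrease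
(`integral_geometric_shift`); neither convexity nor convergence of the local method is needed. The
choice of p makes this a small share of the total, and `integral_potential_le` gives E[‖F(xᵗ⁺¹)‖² +
64a f(xᵗ⁺¹) + 4a² r] ≤ E[67 e + 64a f(xᵗ)].

The error e contracts by (1 − β)² up to multiples of D·d and D·r (`sum_norm_sq_nextEstimate_le`, the
variance of sampling without replacement), and d contracts because of the coin. In `lyapunov` these
contractions pay for 67 e, and 4a² r pays for all r-terms because a ≥ 22 δ_m/√p_B. The function
starts at 64a f(x⁰), since g⁰ is exact and w⁰ = x⁰, and stays above 64a inf f. Telescoping and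
averaging over τ give the accuracy.

Although the number of local steps is unbounded, all expectations of state functions are finite:
descent of the model confines the state at each fixed t to a ball that does not depend on the draws
(`exists_norm_iterState_le`).

The costs follow by executing the algorithm symbolically into an explicit list of rounds and taking
expectations of the geometric and Bernoulli variables in it. -/

namespace FedOpt

noncomputable section

open scoped RealInnerProductSpace

/-! ### Gradients and the descent lemma -/

section Gradients

variable {E : Type} [NormedAddCommGroup E] [InnerProductSpace ℝ E] [CompleteSpace E]

/-- The descent lemma. -/
theorem le_quadratic_of_lipschitz_gradient {f : E → ℝ} (hf : Differentiable ℝ f) {L : ℝ}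
    (hL : ∀ x y, ‖gradient f x - gradient f y‖ ≤ L * ‖x - y‖) (x y : E) :
    f y ≤ f x + ⟪gradient f x, y - x⟫ + L / 2 * ‖y - x‖ ^ 2 := by
  set v := y - x with hv
  let φ : ℝ → ℝ := fun t => f (x + t • v) - t * ⟪gradient f x, v⟫ - L / 2 * t ^ 2 * ‖v‖ ^ 2
  have hder : ∀ t, HasDerivAt φ
      (⟪gradient f (x + t • v), v⟫ - ⟪gradient f x, v⟫ - L * t * ‖v‖ ^ 2) t := by
    intro t
    have h1 : HasDerivAt (fun t : ℝ => x + t • v) v t := by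
      simpa using ((hasDerivAt_id t).smul_const v).const_add x
    have h2 : HasDerivAt (fun t : ℝ => f (x + t • v)) ⟪gradient f (x + t • v), v⟫ t := by
      rw [inner_gradient_left]
      exact (hf (x + t • v)).hasFDerivAt.comp_hasDerivAt t h1
    have h3 : HasDerivAt (fun t : ℝ => t * ⟪gradient f x, v⟫) ⟪gradient f x, v⟫ t := by
      simpa using (hasDerivAt_id t).mul_const ⟪gradient f x, v⟫
    have h4 : HasDerivAt (fun t : ℝ => L / 2 * t ^ 2 * ‖v‖ ^ 2) (L * t * ‖v‖ ^ 2) t := by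
      have := ((hasDerivAt_pow 2 t).const_mul (L / 2)).mul_const (‖v‖ ^ 2)
      refine this.congr_deriv ?_
      push_cast
      ring
    exact (h2.sub h3).sub h4
  have hanti : AntitoneOn φ (Set.Icc 0 1) := by
    refine antitoneOn_of_deriv_nonpos (convex_Icc 0 1)
      (fun t _ => (hder t).continuousAt.continuousWithinAt)
      (fun t _ => (hder t).differentiableAt.differentiableWithinAt) fun t ht => ?_
    rw [interior_Icc] at ht
    rw [(hder t).deriv, ← inner_sub_left]
    have h1 := real_inner_le_norm (gradient f (x + t • v) - gradient f x) v
    have h2 := hL (x + t • v) x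
    rw [add_sub_cancel_left, norm_smul, Real.norm_of_nonneg ht.1.le] at h2
    nlinarith [mul_le_mul_of_nonneg_right h2 (norm_nonneg v)]
  have h := hanti (Set.left_mem_Icc.2 zero_le_one) (Set.right_mem_Icc.2 zero_le_one) zero_le_one
  simp only [φ, one_smul, zero_smul, add_zero, hv, add_sub_cancel] at h
  rw [hv]
  linarith

theorem HasGradientAt.sub' {f g : E → ℝ} {f' g' x : E} (hf : HasGradientAt f f' x)
    (hg : HasGradientAt g g' x) : HasGradientAt (fun z => f z - g z) (f' - g') x := by
  rw [hasGradientAt_iff_hasFDerivAt] at *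
  rw [map_sub]
  exact hf.sub hg

end Gradients

/-! ### Deterministic analysis of the local composite gradient method -/

section CGM

variable {E : Type} [NormedAddCommGroup E] [InnerProductSpace ℝ E]

/-- One step of the local composite gradient method, for the gradient map `G`. -/
def cgmMap (G : E → E) (L lam : ℝ) (x g y : E) : E :=
  cgmStep L lam x g (G x) y (G y)

/-- The subproblem which the local composite gradient method solves. -/
def cgmModel (f₁ : E → ℝ) (G : E → E) (lam : ℝ) (x g z : E) : ℝ :=
  f₁ z + ⟪g - G x, z - x⟫ + lam / 2 * ‖z - x‖ ^ 2

/-- The first-order condition of the step, solved for the gradient at `y`, so that this gradient can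
be eliminated from the descent lemma and from the model gradient. -/
theorem cgmMap_smul {L lam : ℝ} (h : lam + L ≠ 0) (G : E → E) (x g y : E) :
    G y = -((lam + L) • (cgmMap G L lam x g y - y)) - lam • (y - x) - (g - G x) := by
  have : (lam + L) • cgmMap G L lam x g y = L • y + lam • x + G x - g - G y := by
    rw [cgmMap, cgmStep, smul_smul, mul_one_div_cancel h, one_smul]
  rw [smul_sub, this]
  module

variable {f₁ : E → ℝ} {G : E → E} {L lam : ℝ}

/-- The step minimises a quadratic upper bound of the model whose curvature is `L + lam`. The
first-order condition yields `-(L + lam)` times the squared step; the two quadratic terms give back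
half of it. -/
theorem cgmModel_cgmMap_le (h : lam + L ≠ 0)
    (hdesc : ∀ x y, f₁ y ≤ f₁ x + ⟪G x, y - x⟫ + L / 2 * ‖y - x‖ ^ 2) (x g y : E) :
    cgmModel f₁ G lam x g (cgmMap G L lam x g y) +
      (L + lam) / 2 * ‖cgmMap G L lam x g y - y‖ ^ 2 ≤ cgmModel f₁ G lam x g y := by
  have hG := cgmMap_smul h G x g y
  have hd := hdesc y (cgmMap G L lam x g y)
  obtain ⟨u, hu⟩ : ∃ u, u = cgmMap G L lam x g y - y := ⟨_, rfl⟩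
  obtain ⟨v, hv⟩ : ∃ v, v = y - x := ⟨_, rfl⟩
  obtain ⟨c, hc⟩ : ∃ c, c = g - G x := ⟨_, rfl⟩
  have e1 : cgmMap G L lam x g y - x = v + u := by rw [hu, hv]; abel
  simp only [cgmModel, e1]
  rw [← hu] at hd hG ⊢
  rw [← hv, ← hc] at hG
  rw [← hv, ← hc, norm_add_sq_real, inner_add_right]
  rw [hG] at hd
  simp only [inner_sub_left, inner_neg_left, real_inner_smul_left, real_inner_self_eq_norm_sq] at hd
  linarith

/-- By the first-order condition the model gradient at the new point `z` is `(G z - G y) - L • (z -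
y)`, two terms of norm at most `L * ‖z - y‖`. -/
theorem norm_sq_gradient_cgmModel_le (h : lam + L ≠ 0) (hL : ∀ x y, ‖G x - G y‖ ≤ L * ‖x - y‖)
    (x g y : E) :
    ‖G (cgmMap G L lam x g y) + (g - G x) + lam • (cgmMap G L lam x g y - x)‖ ^ 2 ≤
      4 * L ^ 2 * ‖cgmMap G L lam x g y - y‖ ^ 2 := by
  have hG := cgmMap_smul h G x g y
  have h1 : G (cgmMap G L lam x g y) + (g - G x) + lam • (cgmMap G L lam x g y - x) =
      (G (cgmMap G L lam x g y) - G y) - L • (cgmMap G L lam x g y - y) := by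
    have h2 : g - G x = -((lam + L) • (cgmMap G L lam x g y - y)) - lam • (y - x) - G y := by
      rw [hG]
      abel
    rw [h2]
    module
  have h2 := hL (cgmMap G L lam x g y) y
  rw [h1]
  have h3 := norm_sub_le (G (cgmMap G L lam x g y) - G y) (L • (cgmMap G L lam x g y - y))
  -- The sign of `L` is not assumed; the Lipschitz bound itself makes this product nonnegative.
  have h0 : 0 ≤ L * ‖cgmMap G L lam x g y - y‖ := (norm_nonneg _).trans h2
  have h4 : ‖L • (cgmMap G L lam x g y - y)‖ = L * ‖cgmMap G L lam x g y - y‖ := by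
    rw [norm_smul, Real.norm_eq_abs, ← abs_norm (cgmMap G L lam x g y - y), ← abs_mul, abs_norm,
      abs_of_nonneg h0]
  calc _ ≤ (2 * (L * ‖cgmMap G L lam x g y - y‖)) ^ 2 := by
        gcongr
        linarith
    _ = _ := by ring

variable {f : E → ℝ} {F : E → E} {Δ : ℝ}

/-- The decrease of the objective is compared with that of the model. -/
theorem sub_cgmModel_le
    (hdesc : ∀ x y, f y - f₁ y ≤ f x - f₁ x + ⟪F x - G x, y - x⟫ + Δ / 2 * ‖y - x‖ ^ 2)
    (x g z : E) :
    cgmModel f₁ G lam x g x - cgmModel f₁ G lam x g z ≤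
      f x - f z + ⟪F x - g, z - x⟫ - (lam - Δ) / 2 * ‖z - x‖ ^ 2 := by
  have h := hdesc x z
  have e : F x - G x = (F x - g) + (g - G x) := by abel
  rw [e, inner_add_left] at h
  simp only [cgmModel, sub_self, inner_zero_right, norm_zero]
  linarith

theorem inner_le_sq_add {a : ℝ} (ha : 0 < a) (u v : E) :
    ⟪u, v⟫ ≤ ‖u‖ ^ 2 / a + a / 4 * ‖v‖ ^ 2 := by
  have h1 := real_inner_le_norm u v
  have h2 : 0 ≤ (‖u‖ - a / 2 * ‖v‖) ^ 2 / a := by positivity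
  have h3 : (‖u‖ - a / 2 * ‖v‖) ^ 2 / a = ‖u‖ ^ 2 / a + a / 4 * ‖v‖ ^ 2 - ‖u‖ * ‖v‖ := by
    field_simp
    ring
  linarith

/-- A point at which the model does not exceed its value at the centre is close to the centre. -/
theorem norm_sq_le_of_cgmModel_le (ha : 0 < lam - Δ)
    (hdesc : ∀ x y, f y - f₁ y ≤ f x - f₁ x + ⟪F x - G x, y - x⟫ + Δ / 2 * ‖y - x‖ ^ 2)
    {x g z : E} (hz : cgmModel f₁ G lam x g z ≤ cgmModel f₁ G lam x g x) :
    (lam - Δ) / 4 * ‖z - x‖ ^ 2 ≤ f x - f z + ‖F x - g‖ ^ 2 / (lam - Δ) := by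
  have h1 := sub_cgmModel_le (lam := lam) hdesc x g z
  have h2 := inner_le_sq_add ha (F x - g) (z - x)
  linarith

/-- One-step descent, iterated. The bound is uniform in `k`, which is what later makes an unbounded
random number of steps harmless. -/
theorem cgmModel_iterate_le (h : 0 < lam + L)
    (hdesc : ∀ x y, f₁ y ≤ f₁ x + ⟪G x, y - x⟫ + L / 2 * ‖y - x‖ ^ 2) (x g : E) (k : ℕ) :
    cgmModel f₁ G lam x g ((cgmMap G L lam x g)^[k] x) ≤ cgmModel f₁ G lam x g x := by
  induction k with
  | zero => exact le_rfl
  | succ k ih =>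
    rw [Function.iterate_succ_apply']
    have h1 := cgmModel_cgmMap_le h.ne' hdesc x g ((cgmMap G L lam x g)^[k] x)
    have h2 : 0 ≤ (L + lam) / 2 * ‖cgmMap G L lam x g ((cgmMap G L lam x g)^[k] x) -
      (cgmMap G L lam x g)^[k] x‖ ^ 2 := mul_nonneg (by linarith) (sq_nonneg _)
    linarith

theorem norm_add_three_sq_le {E : Type*} [SeminormedAddCommGroup E] (u v w : E) :
    ‖u + v + w‖ ^ 2 ≤ 3 * ‖u‖ ^ 2 + 3 * ‖v‖ ^ 2 + 3 * ‖w‖ ^ 2 := by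
  have h1 := norm_add₃_le (a := u) (b := v) (c := w)
  have h2 : ‖u + v + w‖ ^ 2 ≤ (‖u‖ + ‖v‖ + ‖w‖) ^ 2 := by gcongr
  nlinarith [sq_nonneg (‖u‖ - ‖v‖), sq_nonneg (‖u‖ - ‖w‖), sq_nonneg (‖v‖ - ‖w‖)]

/-- The decrease of the potential in one composite gradient step, in terms of the decrease of the
model. -/
theorem potential_cgmMap_le (hΔ : 0 ≤ Δ) (hL0 : 0 < L) (hlam : 3 * Δ ≤ lam) (ha : 0 < lam - Δ)
    (hL : ∀ x y, ‖G x - G y‖ ≤ L * ‖x - y‖)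
    (hH : ∀ x y, ‖(F x - G x) - (F y - G y)‖ ≤ Δ * ‖x - y‖)
    (hdesc₁ : ∀ x y, f₁ y ≤ f₁ x + ⟪G x, y - x⟫ + L / 2 * ‖y - x‖ ^ 2)
    (hdesc : ∀ x y, f y - f₁ y ≤ f x - f₁ x + ⟪F x - G x, y - x⟫ + Δ / 2 * ‖y - x‖ ^ 2)
    (x g y z : E) (hz : z = cgmMap G L lam x g y) :
    ‖F z‖ ^ 2 + 64 * (lam - Δ) * f z + 4 * (lam - Δ) ^ 2 * ‖z - x‖ ^ 2 ≤
      67 * ‖F x - g‖ ^ 2 + 64 * (lam - Δ) * f x +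
        24 * L ^ 2 / (L + lam) * (cgmModel f₁ G lam x g y - cgmModel f₁ G lam x g z) -
        64 * (lam - Δ) * (cgmModel f₁ G lam x g x - cgmModel f₁ G lam x g z) := by
  have hs : 0 < L + lam := by linarith
  have hs' : lam + L ≠ 0 := by linarith
  have h1 := cgmModel_cgmMap_le hs' hdesc₁ x g y
  have h2 := norm_sq_gradient_cgmModel_le hs' hL x g y
  rw [← hz] at h1 h2
  have h3 := sub_cgmModel_le (lam := lam) hdesc x g z
  set a := lam - Δ with ha'
  set R := G z + (g - G x) + lam • (z - x) with hR
  -- Model gradient, plus estimation error, plus the change of ∇h₁ less the gradient of the proximal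
  -- term.
  have h4 : F z = R + (F x - g) + (((F z - G z) - (F x - G x)) - lam • (z - x)) := by
    rw [hR]; abel
  -- The bound `Δ + lam ≤ 2 * (lam - Δ)` is exactly `hlam`.
  have h5 : ‖((F z - G z) - (F x - G x)) - lam • (z - x)‖ ≤ 2 * a * ‖z - x‖ := by
    have := norm_sub_le ((F z - G z) - (F x - G x)) (lam • (z - x))
    rw [norm_smul, Real.norm_of_nonneg (by linarith : 0 ≤ lam)] at this
    nlinarith [hH z x, norm_nonneg (z - x)]
  have h6 : ‖((F z - G z) - (F x - G x)) - lam • (z - x)‖ ^ 2 ≤ 4 * a ^ 2 * ‖z - x‖ ^ 2 := by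
    calc _ ≤ (2 * a * ‖z - x‖) ^ 2 := by gcongr
      _ = _ := by ring
  have h7 : ‖F z‖ ^ 2 ≤ 3 * ‖R‖ ^ 2 + 3 * ‖F x - g‖ ^ 2 +
      3 * ‖((F z - G z) - (F x - G x)) - lam • (z - x)‖ ^ 2 := by
    conv_lhs => rw [h4]
    exact norm_add_three_sq_le _ _ _
  have h8 : 12 * L ^ 2 * ‖z - y‖ ^ 2 ≤
      24 * L ^ 2 / (L + lam) * (cgmModel f₁ G lam x g y - cgmModel f₁ G lam x g z) := by
    have : 12 * L ^ 2 * ‖z - y‖ ^ 2 =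
        24 * L ^ 2 / (L + lam) * ((L + lam) / 2 * ‖z - y‖ ^ 2) := by
      field_simp
      ring
    rw [this]
    gcongr
    linarith
  have h9 := inner_le_sq_add ha (F x - g) (z - x)
  have h10 : 64 * a * ⟪F x - g, z - x⟫ ≤ 64 * ‖F x - g‖ ^ 2 + 16 * a ^ 2 * ‖z - x‖ ^ 2 := by
    calc _ ≤ 64 * a * (‖F x - g‖ ^ 2 / a + a / 4 * ‖z - x‖ ^ 2) := by gcongr
      _ = _ := by field_simp; ring
  have h11 := mul_le_mul_of_nonneg_left h3 (by positivity : 0 ≤ 64 * a)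
  -- At `‖F x - g‖ ^ 2` the coefficient is 67 = 3 + 64. At `‖z - x‖ ^ 2`, the 32a² from the model
  -- lose 16a² to Young's inequality and 12a² to `h6`, which leaves 4a².
  linarith

end CGM

/-! ### Second moments of sampling without replacement -/

section Sampling

variable {E : Type} [NormedAddCommGroup E] [InnerProductSpace ℝ E]

/-- Pascal's rule splits the diagonal count so that one part is common to all pairs. The case `m =
1` is separate because truncated subtraction would count one subset instead of none. -/
theorem card_filter_mem_powersetCard {n m : ℕ} (hn : 2 ≤ n) (hm : 1 ≤ m) (i j : Fin n) :
    (((Finset.univ.powersetCard m).filter fun C : Finset (Fin n) => i ∈ C ∧ j ∈ C).card : ℝ) =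
      (if m = 1 then 0 else ((n - 2).choose (m - 2) : ℝ)) +
        if i = j then ((n - 2).choose (m - 1) : ℝ) else 0 := by
  have hf : ((Finset.univ.powersetCard m).filter fun C : Finset (Fin n) => i ∈ C ∧ j ∈ C) =
      (Finset.univ.powersetCard m).filter fun C => {i, j} ⊆ C := by
    ext C
    simp [Finset.insert_subset_iff]
  rw [hf]
  by_cases hij : i = j
  · subst hij
    rw [Finset.card_filter_powersetCard_subset _ _ _ (Finset.subset_univ _) (by simpa using hm)]
    simp only [Finset.pair_eq_singleton, Finset.card_singleton, Finset.card_univ,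
      Fintype.card_fin, if_true]
    obtain ⟨N, rfl⟩ := Nat.exists_eq_add_of_le' hn
    obtain ⟨M, rfl⟩ := Nat.exists_eq_add_of_le' hm
    rcases M with _ | M
    · simp
    · have : (N + 1).choose (M + 1) = N.choose M + N.choose (M + 1) := Nat.choose_succ_succ _ _
      simp [this]
  · rw [if_neg hij, add_zero]
    have hc : ({i, j} : Finset (Fin n)).card = 2 := Finset.card_pair hij
    by_cases h1 : m = 1
    · rw [if_pos h1, Nat.cast_eq_zero, Finset.card_eq_zero, Finset.filter_eq_empty_iff]
      intro C hC hsub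
      have := Finset.card_le_card hsub
      rw [(Finset.mem_powersetCard.1 hC).2, hc] at this
      omega
    · rw [if_neg h1, Finset.card_filter_powersetCard_subset _ _ _ (Finset.subset_univ _)
        (by rw [hc]; omega), hc, Finset.card_univ, Fintype.card_fin]

/-- After expansion into pairs, the count common to all pairs multiplies `‖∑ i, v i‖ ^ 2 = 0`; only
the diagonal survives. -/
theorem sum_powersetCard_norm_sq {n m : ℕ} (hn : 2 ≤ n) (hm : 1 ≤ m)
    (v : Fin n → E) (hv : ∑ i, v i = 0) :
    ∑ C ∈ (Finset.univ : Finset (Fin n)).powersetCard m, ‖∑ i ∈ C, v i‖ ^ 2 =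
      ((n - 2).choose (m - 1) : ℝ) * ∑ i, ‖v i‖ ^ 2 := by
  have h1 : ∀ C : Finset (Fin n), ‖∑ i ∈ C, v i‖ ^ 2 =
      ∑ i, ∑ j, if i ∈ C ∧ j ∈ C then ⟪v i, v j⟫ else 0 := by
    intro C
    rw [← real_inner_self_eq_norm_sq, sum_inner]
    simp_rw [inner_sum, ite_and]
    simp
  simp_rw [h1]
  rw [Finset.sum_comm]
  simp_rw [Finset.sum_comm (s := Finset.univ.powersetCard m), ← Finset.sum_filter,
    Finset.sum_const, nsmul_eq_mul, card_filter_mem_powersetCard hn hm, add_mul,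
    Finset.sum_add_distrib, ← Finset.mul_sum, ← inner_sum, hv]
  simp [Finset.mul_sum]

/-- The variance of the mean of a sample drawn without replacement. -/
theorem sum_powersetCard_norm_sq_mean {n m : ℕ} (hm : 1 ≤ m) (hmn : m ≤ n)
    (v : Fin n → E) (hv : ∑ i, v i = 0) :
    ∑ C ∈ (Finset.univ : Finset (Fin n)).powersetCard m,
        1 / (n.choose m : ℝ) * ‖(1 / (m : ℝ)) • ∑ i ∈ C, v i‖ ^ 2 =
      (((n : ℝ) - m) / ((n : ℝ) - 1)) / m * (1 / (n : ℝ) * ∑ i, ‖v i‖ ^ 2) := by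
  -- For `n = 1` the factor divides by zero, but the single vector vanishes and both sides are 0.
  rcases (show n = 1 ∨ 2 ≤ n by omega) with rfl | hn
  · have hv0 : v = fun _ => 0 := by
      ext i
      rw [Subsingleton.elim i 0]
      simpa using hv
    simp [hv0]
  simp_rw [norm_smul, mul_pow]
  rw [← Finset.mul_sum, ← Finset.mul_sum, sum_powersetCard_norm_sq hn hm v hv]
  obtain ⟨N, rfl⟩ := Nat.exists_eq_add_of_le' hn
  obtain ⟨M, rfl⟩ := Nat.exists_eq_add_of_le' hm
  have hMN : M ≤ N + 1 := by omega
  -- Two absorption identities that express C(n − 2, m − 1) through C(n, m).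
  have e1 : ((N + 2 : ℕ) : ℝ) * ((N + 1).choose M : ℝ) = ((N + 2).choose (M + 1) : ℝ) * (M + 1 : ℕ) := by
    exact_mod_cast Nat.add_one_mul_choose_eq (N + 1) M
  have e2 : (N.choose M : ℝ) * (N + 1) = ((N + 1).choose M : ℝ) * ((N + 1 : ℝ) - M) := by
    have := Nat.choose_mul_succ_eq N M
    have h2 : ((N + 1 - M : ℕ) : ℝ) = (N + 1 : ℝ) - M := by
      rw [Nat.cast_sub hMN]; push_cast; ring
    rw [← h2]
    exact_mod_cast this
  have hc : (0 : ℝ) < ((N + 2).choose (M + 1) : ℝ) := by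
    exact_mod_cast Nat.choose_pos (by omega)
  push_cast at e1
  simp only [Nat.add_sub_cancel]
  have key : 1 / ((N + 2).choose (M + 1) : ℝ) * ((1 / ((M : ℝ) + 1)) ^ 2 * (N.choose M : ℝ)) =
      ((N : ℝ) + 2 - (M + 1)) / ((N : ℝ) + 2 - 1) / ((M : ℝ) + 1) * (1 / ((N : ℝ) + 2)) := by
    have hN1 : (N : ℝ) + 2 - 1 ≠ 0 := by
      have : (0 : ℝ) ≤ N := N.cast_nonneg
      linarith
    field_simp
    linear_combination ((N : ℝ) + 2) * e2 + ((N : ℝ) + 1 - M) * e1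
  push_cast
  rw [Real.norm_of_nonneg (by positivity)]
  linear_combination (∑ i, ‖v i‖ ^ 2) * key

end Sampling

/-! ### The blocks of a full synchronization -/

theorem biUnion_block {n m : ℕ} (hm : 1 ≤ m) (j : ℕ) :
    ((Finset.range j).biUnion fun i => block n m i) =
      Finset.univ.filter fun i : Fin n => (i : ℕ) < j * m := by
  ext i
  simp only [Finset.mem_biUnion, Finset.mem_range, block, Finset.mem_filter, Finset.mem_univ,
    true_and]
  constructor
  · rintro ⟨k, hk, h1, h2⟩
    have : (k + 1) * m ≤ j * m := Nat.mul_le_mul_right _ hk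
    rw [add_mul, one_mul] at this
    omega
  · intro h
    refine ⟨i / m, (Nat.div_lt_iff_lt_mul hm).2 h, Nat.div_mul_le_self _ _, ?_⟩
    have := Nat.lt_div_mul_add (a := (i : ℕ)) hm
    omega

/-- The blocks are disjoint, and they exhaust the clients because `n ≤ ⌈n / m⌉₊ * m`. -/
theorem sum_range_sum_block {n m : ℕ} {E : Type*} [AddCommMonoid E] (hm : 1 ≤ m) (v : Fin n → E) :
    ∑ j ∈ Finset.range ⌈(n : ℝ) / m⌉₊, ∑ i ∈ block n m j, v i = ∑ i, v i := by
  rw [← Finset.sum_biUnion, biUnion_block hm]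
  · congr 1
    rw [Finset.filter_eq_self]
    intro i _
    have h1 : (n : ℝ) / m ≤ ⌈(n : ℝ) / m⌉₊ := Nat.le_ceil _
    rw [div_le_iff₀ (by exact_mod_cast hm)] at h1
    have h2 : n ≤ ⌈(n : ℝ) / m⌉₊ * m := by exact_mod_cast h1
    exact i.2.trans_le h2
  · intro a _ b _ hab
    rw [Function.onFun, Finset.disjoint_left]
    intro i ha hb
    simp only [block, Finset.mem_filter, Finset.mem_univ, true_and] at ha hb
    rcases lt_or_gt_of_ne hab with h | h
    · have : (a + 1) * m ≤ b * m := Nat.mul_le_mul_right _ h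
      rw [add_mul, one_mul] at this
      omega
    · have : (b + 1) * m ≤ a * m := Nat.mul_le_mul_right _ h
      rw [add_mul, one_mul] at this
      omega

/-! ### Values of the local methods and of the server update -/

section Means

variable {n : ℕ} {E : Type} [NormedAddCommGroup E] [InnerProductSpace ℝ E]

/-- The mean of the maps `G i` over all clients. -/
def fullMean (G : Fin n → E → E) (x : E) : E := (1 / (n : ℝ)) • ∑ i, G i x

/-- The mean of the maps `G i` over a sample of size `m`. -/
def sampleMean (m : ℕ) (G : Fin n → E → E) (C : Finset (Fin n)) (x : E) : E :=
  (1 / (m : ℝ)) • ∑ i ∈ C, G i x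

/-- The next gradient estimate of RG-SVRG. -/
def nextEstimate (m : ℕ) (G : Fin n → E → E) (β : ℝ) (C : Finset (Fin n)) (x g w x' : E) : E :=
  (1 - β) • g + β • (sampleMean m G C x + fullMean G w - sampleMean m G C w) +
    sampleMean m G C x' - sampleMean m G C x

theorem result_cgmSteps (O : E → ℝ × E) (L lam : ℝ) (x g : E) (k : ℕ) (y : E) :
    (cgmSteps L lam x g (O x).2 k y).result O =
      (cgmMap (fun z => (O z).2) L lam x g)^[k] y := by
  induction k generalizing y with
  | zero => rfl
  | succ k ih => rw [cgmSteps, LocalMethod.result, ih]; rfl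

theorem queries_cgmSteps (O : E → ℝ × E) (L lam : ℝ) (x g c : E) (k : ℕ) (y : E) :
    (cgmSteps L lam x g c k y).queries O = k := by
  induction k generalizing y with
  | zero => rfl
  | succ k ih => rw [cgmSteps, LocalMethod.queries, ih]

theorem result_cgm (O : E → ℝ × E) (L lam : ℝ) (k : ℕ) (x g : E) :
    (cgm L lam k x g).result O = (cgmMap (fun z => (O z).2) L lam x g)^[k + 1] x := by
  rw [cgm, LocalMethod.result, result_cgmSteps]
  rfl

theorem queries_cgm (O : E → ℝ × E) (L lam : ℝ) (k : ℕ) (x g : E) :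
    (cgm L lam k x g).queries O = k + 1 := by
  rw [cgm, LocalMethod.queries, queries_cgmSteps]

theorem rgSvrgUpdate_eq {m : ℕ} (β : ℝ) (G : Fin n → E → E) (C : Finset (Fin n)) (x g w x' : E) :
    rgSvrgUpdate m β g (fullMean G w) C (fun i => (G i x', G i x, G i w)) =
      nextEstimate m G β C x g w x' := by
  simp only [rgSvrgUpdate, nextEstimate, sampleMean]
  rw [Finset.sum_coe_sort C fun i => G i x', Finset.sum_coe_sort C fun i => G i x,
    Finset.sum_coe_sort C fun i => G i w]

end Means

/-! ### Symbolic execution of the algorithm -/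

section Semantics

variable {n m : ℕ} [NeZero n] {E A : Type} [NormedAddCommGroup E] [InnerProductSpace ℝ E]

/-- One iteration of I-CGM-RG-SVRG on the triples `(xᵗ, gᵗ, wᵗ)`. -/
def nextState (m : ℕ) (G : Fin n → E → E) (L lam β : ℝ) (k : ℕ) (C : Finset (Fin n)) (b : Bool)
    (s : E × E × E) : E × E × E :=
  let x' := (cgmMap (G 0) L lam s.1 s.2.1)^[k + 1] s.1
  (x', nextEstimate m G β C s.1 s.2.1 s.2.2 x', if b then x' else s.2.2)

/-- The triples `(xᵗ, gᵗ, wᵗ)`. -/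
def iterState (m : ℕ) (G : Fin n → E → E) (L lam β : ℝ) (x₀ : E) (K : ℕ → ℕ)
    (S : ℕ → Finset (Fin n)) (coin : ℕ → Bool) : ℕ → E × E × E
  | 0 => (x₀, fullMean G x₀, x₀)
  | t + 1 => nextState m G L lam β (K t) (S t) (coin (t + 1))
      (iterState m G L lam β x₀ K S coin t)

/-- The rounds of the collection of gradients from the blocks `0, …, j - 1`. -/
def syncRounds (n m : ℕ) : ℕ → List Round
  | 0 => []
  | j + 1 => ⟨.ass, (block n m j).sup fun _ => 1⟩ :: syncRounds n m j

variable (O : Fin n → E → ℝ × E)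

theorem output_collectGradients (x : E) (next : E → FedAlgorithm n m E A) (j : ℕ) (acc : E)
    (S : ℕ → Finset (Fin n)) :
    (collectGradients x next j acc).output O S =
      (next (acc + (1 / (n : ℝ)) • ∑ k ∈ Finset.range j, ∑ i ∈ block n m k, (O i x).2)).output
        O S := by
  induction j generalizing acc with
  | zero => simp [collectGradients]
  | succ j ih =>
    rw [collectGradients, FedAlgorithm.output, ih, Finset.sum_range_succ, smul_add]
    simp only [LocalMethod.result]
    rw [Finset.sum_coe_sort (block n m j) fun i => (O i x).2, add_assoc, add_comm (_ • _) (_ • _)]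

theorem rounds_collectGradients (x : E) (next : E → FedAlgorithm n m E A) (j : ℕ) (acc : E)
    (S : ℕ → Finset (Fin n)) :
    (collectGradients x next j acc).rounds O S = syncRounds n m j ++
      (next (acc + (1 / (n : ℝ)) • ∑ k ∈ Finset.range j, ∑ i ∈ block n m k, (O i x).2)).rounds
        O S := by
  induction j generalizing acc with
  | zero => simp [collectGradients, syncRounds]
  | succ j ih =>
    rw [collectGradients, FedAlgorithm.rounds, ih, Finset.sum_range_succ, smul_add, syncRounds]
    simp only [LocalMethod.result, LocalMethod.queries]
    rw [Finset.sum_coe_sort (block n m j) fun i => (O i x).2, add_assoc, add_comm (_ • _) (_ • _)]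
    rfl

theorem output_fullSync (hm : 1 ≤ m) (x : E) (next : E → FedAlgorithm n m E A)
    (S : ℕ → Finset (Fin n)) :
    (fullSync x next).output O S = (next (fullMean (fun i y => (O i y).2) x)).output O S := by
  rw [fullSync, output_collectGradients, sum_range_sum_block hm, zero_add]
  rfl

theorem rounds_fullSync (hm : 1 ≤ m) (x : E) (next : E → FedAlgorithm n m E A)
    (S : ℕ → Finset (Fin n)) :
    (fullSync x next).rounds O S = syncRounds n m ⌈(n : ℝ) / m⌉₊ ++
      (next (fullMean (fun i y => (O i y).2) x)).rounds O S := by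
  rw [fullSync, rounds_collectGradients, sum_range_sum_block hm, zero_add]
  rfl

variable (L lam β : ℝ) (x₀ : E) (K : ℕ → ℕ) (S : ℕ → Finset (Fin n)) (coin : ℕ → Bool) (τ : ℕ)

/-- The rounds of the iterations `t, …, t + r - 1`. -/
def loopRounds (n m : ℕ) (K : ℕ → ℕ) (S : ℕ → Finset (Fin n)) (coin : ℕ → Bool) :
    ℕ → ℕ → List Round
  | 0, _ => []
  | r + 1, t => ⟨.dss, K t + 1⟩ :: ⟨.rss, (S t).sup fun _ => 3⟩ ::
      ((if coin (t + 1) then syncRounds n m ⌈(n : ℝ) / m⌉₊ else []) ++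
        loopRounds n m K S coin r (t + 1))

/-- Each iteration writes one entry of `hist`, so the final lookup finds a new iterate if `τ` lies
among the iterations still to be done and the old entry otherwise. The stream of samples is shifted
by `t` because every random round consumes one. -/
theorem output_icgmLoop (hm : 1 ≤ m) (G : Fin n → E → E) (hG : G = fun i y => (O i y).2)
    (r t : ℕ) (hist : ℕ → E) (s : E × E × E) (hs : s = iterState m G L lam β x₀ K S coin t) :
    (icgmLoop (n := n) (m := m) L lam β K coin τ r t s.1 s.2.1 s.2.2 (fullMean G s.2.2)
        hist).output O (fun j => S (t + j)) =
      if t < τ ∧ τ ≤ t + r then (iterState m G L lam β x₀ K S coin τ).1 else hist τ := by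
  induction r generalizing t hist s with
  | zero =>
    rw [icgmLoop, FedAlgorithm.output, if_neg (by omega)]
  | succ r ih =>
    have hs' : nextState m G L lam β (K t) (S t) (coin (t + 1)) s =
        iterState m G L lam β x₀ K S coin (t + 1) := by rw [iterState, hs]
    have ih' := ih (t + 1) (Function.update hist (t + 1)
      (nextState m G L lam β (K t) (S t) (coin (t + 1)) s).1) _ hs'
    have hfin : (if t + 1 < τ ∧ τ ≤ t + 1 + r then (iterState m G L lam β x₀ K S coin τ).1
          else Function.update hist (t + 1)
            (nextState m G L lam β (K t) (S t) (coin (t + 1)) s).1 τ) =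
        if t < τ ∧ τ ≤ t + (r + 1) then (iterState m G L lam β x₀ K S coin τ).1 else hist τ := by
      by_cases h1 : τ = t + 1
      · subst h1
        rw [if_neg (by omega), if_pos (by omega), Function.update_self, hs']
      · rw [Function.update_of_ne h1]
        congr 1
        apply propext
        omega
    rw [hfin] at ih'
    rw [← ih', icgmLoop, FedAlgorithm.output, FedAlgorithm.output, result_cgm]
    have hshift : (fun j => S (t + (j + 1))) = fun j => S (t + 1 + j) := by
      funext j; congr 1; omega
    have hg := rgSvrgUpdate_eq (m := m) β G (S (t + 0)) s.1 s.2.1 s.2.2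
      ((cgmMap (G 0) L lam s.1 s.2.1)^[K t + 1] s.1)
    simp only [LocalMethod.result, hshift]
    subst hG
    simp only at hg
    rw [hg]
    by_cases hc : coin (t + 1) = true
    · rw [if_pos hc, output_fullSync O hm]
      simp only [nextState, hc, if_true]
      rfl
    · rw [if_neg hc]
      simp only [nextState, hc]
      rfl

theorem rounds_icgmLoop (hm : 1 ≤ m) (r t : ℕ) (x g w gw : E) (hist : ℕ → E) :
    (icgmLoop (n := n) (m := m) L lam β K coin τ r t x g w gw hist).rounds O
        (fun j => S (t + j)) = loopRounds n m K S coin r t := by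
  induction r generalizing t x g w gw hist with
  | zero => rfl
  | succ r ih =>
    have hshift : (fun j => S (t + (j + 1))) = fun j => S (t + 1 + j) := by
      funext j; congr 1; omega
    rw [icgmLoop, FedAlgorithm.rounds, FedAlgorithm.rounds, queries_cgm, loopRounds]
    simp only [LocalMethod.queries, hshift, add_zero]
    congr 2
    by_cases hc : coin (t + 1) = true
    · rw [if_pos hc, if_pos hc, rounds_fullSync O hm, ih]
    · rw [if_neg hc, if_neg hc, ih, List.nil_append]

theorem output_icgmRgSvrg (hm : 1 ≤ m) (T : ℕ) (G : Fin n → E → E)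
    (hG : G = fun i y => (O i y).2) :
    (icgmRgSvrg n m L lam β T x₀ K coin τ).output O S =
      if τ ≤ T then (iterState m G L lam β x₀ K S coin τ).1 else x₀ := by
  have h := output_icgmLoop O L lam β x₀ K S coin τ hm G hG T 0 (fun _ => x₀) _ rfl
  simp only [zero_add] at h
  rw [icgmRgSvrg, output_fullSync O hm, ← hG]
  refine h.trans ?_
  -- For `τ = 0` no entry is overwritten, and the initial history agrees with the initial state.
  rcases Nat.eq_zero_or_pos τ with rfl | hτ
  · simp [iterState]
  · simp [hτ]

theorem rounds_icgmRgSvrg (hm : 1 ≤ m) (T : ℕ) :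
    (icgmRgSvrg n m L lam β T x₀ K coin τ).rounds O S =
      syncRounds n m ⌈(n : ℝ) / m⌉₊ ++ loopRounds n m K S coin T 0 := by
  rw [icgmRgSvrg, rounds_fullSync O hm]
  congr 1
  have h := rounds_icgmLoop O L lam β K S coin τ hm T 0 x₀
  simp only [zero_add] at h
  apply h

end Semantics

/-! ### Costs of the explicit lists of rounds -/

section Costs

theorem communicationCost_append (a b : ℝ) (l l' : List Round) :
    communicationCost a b (l ++ l') = communicationCost a b l + communicationCost a b l' := by
  simp only [communicationCost, numUses, List.map_append, List.count_append]
  push_cast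
  ring

theorem localCost_append (l l' : List Round) :
    localCost (l ++ l') = localCost l + localCost l' := by
  simp [localCost]

theorem communicationCost_syncRounds (a b : ℝ) (n m j : ℕ) :
    communicationCost a b (syncRounds n m j) = a * j := by
  induction j with
  | zero => simp [syncRounds, communicationCost, numUses]
  | succ j ih =>
    rw [syncRounds, ← List.singleton_append, communicationCost_append, ih]
    simp [communicationCost, numUses]
    ring

/-- Only an inequality, since an empty block costs no query. -/
theorem localCost_syncRounds_le (n m j : ℕ) : localCost (syncRounds n m j) ≤ j := by
  induction j with
  | zero => simp [syncRounds, localCost]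
  | succ j ih =>
    rw [syncRounds, ← List.singleton_append, localCost_append, add_comm]
    refine add_le_add ih ?_
    simp [localCost]

theorem communicationCost_loopRounds (a b : ℝ) (n m : ℕ) (K : ℕ → ℕ) (S : ℕ → Finset (Fin n))
    (coin : ℕ → Bool) (r t : ℕ) :
    communicationCost a b (loopRounds n m K S coin r t) =
      ∑ j ∈ Finset.range r,
        (b + 1 + a * ⌈(n : ℝ) / m⌉₊ * if coin (t + j + 1) then 1 else 0) := by
  induction r generalizing t with
  | zero => simp [loopRounds, communicationCost, numUses]
  | succ r ih =>
    rw [Finset.sum_range_succ', loopRounds, ← List.singleton_append,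
      ← List.singleton_append (l := _ ++ _), communicationCost_append, communicationCost_append,
      communicationCost_append, ih]
    have h1 : ∀ j, t + 1 + j + 1 = t + (j + 1) + 1 := by intro j; omega
    simp only [h1, add_zero]
    split_ifs
    · rw [communicationCost_syncRounds]
      simp [communicationCost, numUses]
      ring
    · simp [communicationCost, numUses]
      ring

theorem localCost_loopRounds (n m : ℕ) (K : ℕ → ℕ) (S : ℕ → Finset (Fin n))
    (coin : ℕ → Bool) (r t : ℕ) :
    localCost (loopRounds n m K S coin r t) =
      ∑ j ∈ Finset.range r, (K (t + j) + 1 + ((S (t + j)).sup fun _ => 3) +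
        if coin (t + j + 1) then localCost (syncRounds n m ⌈(n : ℝ) / m⌉₊) else 0) := by
  induction r generalizing t with
  | zero => simp [loopRounds, localCost]
  | succ r ih =>
    rw [Finset.sum_range_succ', loopRounds, ← List.singleton_append,
      ← List.singleton_append (l := _ ++ _), localCost_append, localCost_append,
      localCost_append, ih]
    have h1 : ∀ j, t + 1 + j = t + (j + 1) := by intro j; omega
    simp only [h1, add_zero]
    split_ifs
    · simp [localCost]
      ring
    · simp [localCost]
      ring

end Costs

/-! ### Independence and the laws of the discrete variables -/

section Independence

variable {Ω : Type*} {mΩ : MeasurableSpace Ω} {μ : Measure Ω} [IsProbabilityMeasure μ]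

/-- Integrating out an independent discrete random variable. -/
theorem integral_le_integral_of_indep {α ι : Type*} [MeasurableSpace α] [Countable ι]
    {X : Ω → α} (hX : Measurable X) {Y : Ω → ι} (hY : Measurable[mΩ, ⊤] Y)
    (hind : Indep (MeasurableSpace.comap X inferInstance) (MeasurableSpace.comap Y ⊤) μ)
    {φ : α → ι → ℝ} (hφ : ∀ k, Measurable fun x => φ x k)
    (hint : Integrable (fun ω => φ (X ω) (Y ω)) μ)
    {ψ : α → ℝ} (hψ : Integrable (fun ω => ψ (X ω)) μ)
    (hle : ∀ x, ∫ ω', φ x (Y ω') ∂μ ≤ ψ x) :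
    ∫ ω, φ (X ω) (Y ω) ∂μ ≤ ∫ ω, ψ (X ω) ∂μ := by
  let _ : MeasurableSpace ι := ⊤
  have hXY : IndepFun X Y μ := by
    rw [IndepFun_iff_Indep]
    exact hind
  have hmap := (indepFun_iff_map_prod_eq_prod_map_map hX.aemeasurable hY.aemeasurable).1 hXY
  have hφ' : Measurable (Function.uncurry φ) := measurable_from_prod_countable_left hφ
  have hXYm : Measurable fun ω => (X ω, Y ω) := hX.prodMk hY
  have hpY : IsProbabilityMeasure (μ.map Y) := Measure.isProbabilityMeasure_map hY.aemeasurable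
  have hint' : Integrable (Function.uncurry φ) ((μ.map X).prod (μ.map Y)) := by
    rw [← hmap, integrable_map_measure hφ'.aestronglyMeasurable hXYm.aemeasurable]
    exact hint
  have h1 : ∫ ω, φ (X ω) (Y ω) ∂μ = ∫ ω, ∫ ω', φ (X ω) (Y ω') ∂μ ∂μ := by
    have e1 : ∫ ω, φ (X ω) (Y ω) ∂μ = ∫ z, Function.uncurry φ z ∂(μ.map fun ω => (X ω, Y ω)) :=
      (integral_map hXYm.aemeasurable hφ'.aestronglyMeasurable).symm
    rw [e1, hmap, integral_prod _ hint', integral_map hX.aemeasurable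
      hint'.integral_prod_left.aestronglyMeasurable]
    congr 1
    ext ω
    exact integral_map hY.aemeasurable (measurable_of_countable _).aestronglyMeasurable
  rw [h1]
  refine integral_mono ?_ hψ fun ω => hle _
  have h2 := (integrable_map_measure hint'.integral_prod_left.aestronglyMeasurable
    hX.aemeasurable).1 hint'.integral_prod_left
  refine h2.congr (Filter.Eventually.of_forall fun ω => ?_)
  exact integral_map hY.aemeasurable (measurable_of_countable _).aestronglyMeasurable

/-- On the push-forward measure the integral is a series. This one statement serves the geometric,
Bernoulli and uniform laws. -/
theorem integrable_and_integral_eq_tsum {Ω : Type*} {mΩ : MeasurableSpace Ω} {μ : Measure Ω}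
    {ι : Type*} [Countable ι] {Y : Ω → ι}
    (hY : Measurable[mΩ, ⊤] Y) {q : ι → ℝ} (hq : ∀ k, 0 ≤ q k)
    (hlaw : ∀ k, μ {ω | Y ω = k} = ENNReal.ofReal (q k)) (b : ι → ℝ)
    (hb : Summable fun k => q k * |b k|) :
    Integrable (fun ω => b (Y ω)) μ ∧ ∫ ω, b (Y ω) ∂μ = ∑' k, q k * b k := by
  let _ : MeasurableSpace ι := ⊤
  have hsing : ∀ k, (μ.map Y) {k} = ENNReal.ofReal (q k) := fun k => by
    rw [Measure.map_apply hY (MeasurableSet.of_discrete)]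
    exact hlaw k
  have hint : Integrable b (μ.map Y) := by
    refine ⟨(measurable_of_countable _).aestronglyMeasurable, ?_⟩
    rw [HasFiniteIntegral, lintegral_countable']
    have : ∀ k, ‖b k‖ₑ * (μ.map Y) {k} = ENNReal.ofReal (q k * |b k|) := fun k => by
      rw [hsing, mul_comm, ENNReal.ofReal_mul (hq k), Real.enorm_eq_ofReal_abs]
    simp_rw [this]
    exact hb.tsum_ofReal_lt_top
  refine ⟨(integrable_map_measure hint.1 hY.aemeasurable).1 hint, ?_⟩
  rw [← integral_map (φ := Y) hY.aemeasurable hint.1, integral_countable hint]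
  congr 1
  ext k
  rw [measureReal_def, hsing, ENNReal.toReal_ofReal (hq k), smul_eq_mul]

theorem summable_geometric_mul_of_bounded {p : ℝ} (hp : 0 < p) (hp1 : p < 1) {b : ℕ → ℝ} {B : ℝ}
    (hb : ∀ k, |b k| ≤ B) : Summable fun k => (1 - p) ^ k * p * |b k| := by
  have h1 : Summable fun k => (1 - p) ^ k * p * B :=
    ((summable_geometric_of_lt_one (by linarith) (by linarith)).mul_right p).mul_right B
  refine h1.of_nonneg_of_le (fun k => ?_) fun k => ?_
  · exact mul_nonneg (mul_nonneg (pow_nonneg (by linarith) k) hp.le) (abs_nonneg _)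
  · exact mul_le_mul_of_nonneg_left (hb k) (mul_nonneg (pow_nonneg (by linarith) k) hp.le)

theorem integrable_comp_of_bounded {ι : Type*} [Countable ι] {Y : Ω → ι}
    (hY : Measurable[mΩ, ⊤] Y) {b : ι → ℝ} {B : ℝ} (hb : ∀ k, |b k| ≤ B) :
    Integrable (fun ω => b (Y ω)) μ := by
  let _ : MeasurableSpace ι := ⊤
  exact Integrable.of_bound ((measurable_of_countable b).comp hY).aestronglyMeasurable B
    (Filter.Eventually.of_forall fun ω => hb _)

/-- A bounded sequence that vanishes at `0`, evaluated at a geometric variable. -/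
theorem integral_geometric_shift {Ω : Type*} {mΩ : MeasurableSpace Ω} {μ : Measure Ω} {p : ℝ}
    {Y : Ω → ℕ} (hp : 0 < p) (hp1 : p < 1) (hY : Measurable[mΩ, ⊤] Y)
    (hlaw : ∀ k, μ {ω | Y ω = k} = ENNReal.ofReal ((1 - p) ^ k * p)) {b : ℕ → ℝ} {B : ℝ}
    (hb : ∀ k, |b k| ≤ B) (hb0 : b 0 = 0) :
    ∫ ω, b (Y ω) ∂μ = (1 - p) * ∫ ω, b (Y ω + 1) ∂μ := by
  have hq : ∀ k : ℕ, 0 ≤ (1 - p) ^ k * p := fun k =>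
    mul_nonneg (pow_nonneg (by linarith) k) hp.le
  have hs := summable_geometric_mul_of_bounded hp hp1 hb
  rw [(integrable_and_integral_eq_tsum hY hq hlaw b hs).2,
    (integrable_and_integral_eq_tsum hY hq hlaw (fun k => b (k + 1))
      (summable_geometric_mul_of_bounded hp hp1 fun k => hb (k + 1))).2]
  have hs' : Summable fun k => (1 - p) ^ k * p * b k := by
    refine Summable.of_norm (hs.congr fun k => ?_)
    rw [norm_mul, Real.norm_of_nonneg (hq k), Real.norm_eq_abs]
  -- The term at 0 drops out, and each remaining weight is `1 - p` times the preceding one.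
  rw [hs'.tsum_eq_zero_add, hb0, mul_zero, zero_add, ← tsum_mul_left]
  congr 1
  ext k
  ring

theorem integral_geometric {Ω : Type*} {mΩ : MeasurableSpace Ω} {μ : Measure Ω} {p : ℝ}
    {Y : Ω → ℕ} (hp : 0 < p) (hp1 : p < 1) (hY : Measurable[mΩ, ⊤] Y)
    (hlaw : ∀ k, μ {ω | Y ω = k} = ENNReal.ofReal ((1 - p) ^ k * p)) :
    Integrable (fun ω => (Y ω : ℝ)) μ ∧ ∫ ω, (Y ω : ℝ) ∂μ = 1 / p - 1 := by
  have hq : ∀ k : ℕ, 0 ≤ (1 - p) ^ k * p := fun k =>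
    mul_nonneg (pow_nonneg (by linarith) k) hp.le
  have hr : ‖1 - p‖ < 1 := by
    rw [Real.norm_of_nonneg (by linarith)]
    linarith
  have hs := (hasSum_coe_mul_geometric_of_norm_lt_one hr).mul_right p
  have e : ∀ k : ℕ, (k : ℝ) * (1 - p) ^ k * p = (1 - p) ^ k * p * |(k : ℝ)| := fun k => by
    rw [abs_of_nonneg k.cast_nonneg]
    ring
  simp_rw [e] at hs
  have h := integrable_and_integral_eq_tsum hY hq hlaw (fun k => (k : ℝ)) hs.summable
  refine ⟨h.1, h.2.trans ?_⟩
  simp only [Nat.abs_cast] at hs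
  rw [hs.tsum_eq, sub_sub_cancel]
  field_simp

theorem integral_bernoulli {pB : ℝ} (h0 : 0 ≤ pB) {c : Ω → Bool} (hc : Measurable[mΩ, ⊤] c)
    (hlaw : μ {ω | c ω = true} = ENNReal.ofReal pB) (b : Bool → ℝ) :
    ∫ ω, b (c ω) ∂μ = pB * b true + (1 - pB) * b false := by
  have h1 : pB ≤ 1 := by
    have : ENNReal.ofReal pB ≤ 1 := hlaw ▸ prob_le_one
    simpa using this
  have hfalse : μ {ω | c ω = false} = ENNReal.ofReal (1 - pB) := by
    have e : {ω | c ω = false} = {ω | c ω = true}ᶜ := by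
      ext ω
      simp
    have hms : MeasurableSet {ω | c ω = true} := hc (t := {true}) trivial
    rw [e, prob_compl_eq_one_sub hms, hlaw, ENNReal.ofReal_sub _ h0, ENNReal.ofReal_one]
  have h := (integrable_and_integral_eq_tsum (μ := μ) hc (q := fun x => cond x pB (1 - pB))
    (fun x => by cases x <;> simp [h0, h1])
    (fun x => by cases x <;> simp [hlaw, hfalse]) b (Summable.of_finite)).2
  rw [h, tsum_fintype]
  simp

/-- The law of a variable that takes every value in `s` with probability `1 / s.card`. -/
theorem integral_uniform {ι : Type*} [Countable ι] {Y : Ω → ι} (hY : Measurable[mΩ, ⊤] Y)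
    {s : Finset ι} (hs : s.Nonempty)
    (hlaw : ∀ k ∈ s, μ {ω | Y ω = k} = ENNReal.ofReal (1 / (s.card : ℝ))) (b : ι → ℝ) :
    ∫ ω, b (Y ω) ∂μ = ∑ k ∈ s, 1 / (s.card : ℝ) * b k := by
  classical
  have hms : ∀ A : Set ι, MeasurableSet {ω | Y ω ∈ A} := fun A => hY (t := A) trivial
  have hc : (s.card : ℝ) ≠ 0 := by exact_mod_cast hs.card_pos.ne'
  -- The prescribed masses on `s` already add up to 1, so every value outside `s` is null although
  -- its law is not prescribed.
  have hmass : μ {ω | Y ω ∈ (s : Set ι)} = 1 := by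
    have e : {ω | Y ω ∈ (s : Set ι)} = ⋃ k ∈ s, {ω | Y ω = k} := by
      ext ω
      simp
    rw [e, measure_biUnion_finset (f := fun k => {ω | Y ω = k}) _ fun k _ => hms {k},
      Finset.sum_congr rfl hlaw,
      Finset.sum_const, ← ENNReal.ofReal_nsmul, nsmul_eq_mul, mul_one_div_cancel hc,
      ENNReal.ofReal_one]
    intro k _ l _ hkl
    rw [Function.onFun, Set.disjoint_left]
    intro ω h1 h2
    exact hkl (h1.symm.trans h2)
  have hlaw' : ∀ k, μ {ω | Y ω = k} =
      ENNReal.ofReal (if k ∈ s then 1 / (s.card : ℝ) else 0) := by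
    intro k
    split_ifs with h
    · exact hlaw k h
    · rw [ENNReal.ofReal_zero]
      have h0 : μ {ω | Y ω ∈ (s : Set ι)}ᶜ = 0 := (prob_compl_eq_zero_iff (hms s)).2 hmass
      refine measure_mono_null (fun ω hω => ?_) h0
      rw [Set.mem_ofPred_eq] at hω
      simpa [hω] using h
  have hzero : ∀ k ∉ s, (if k ∈ s then 1 / (s.card : ℝ) else 0) = 0 := fun k hk => if_neg hk
  rw [(integrable_and_integral_eq_tsum hY (fun k => by positivity) hlaw' b
    (summable_of_ne_finset_zero (s := s) fun k hk => by rw [hzero k hk, zero_mul])).2,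
    tsum_eq_sum (s := s) fun k hk => by rw [hzero k hk, zero_mul]]
  exact Finset.sum_congr rfl fun k hk => by rw [if_pos hk]

theorem integral_uniform_subset {n m : ℕ} (hmn : m ≤ n) {S : Ω → Finset (Fin n)}
    (hS : Measurable[mΩ, ⊤] S)
    (hlaw : ∀ C : Finset (Fin n), C.card = m →
      μ {ω | S ω = C} = ENNReal.ofReal (1 / (n.choose m : ℝ))) (b : Finset (Fin n) → ℝ) :
    ∫ ω, b (S ω) ∂μ =
      ∑ C ∈ (Finset.univ : Finset (Fin n)).powersetCard m, 1 / (n.choose m : ℝ) * b C := by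
  have hcard : ((Finset.univ : Finset (Fin n)).powersetCard m).card = n.choose m := by
    rw [Finset.card_powersetCard, Finset.card_univ, Fintype.card_fin]
  have h := integral_uniform hS (s := (Finset.univ : Finset (Fin n)).powersetCard m)
    (by rw [← Finset.card_pos, hcard]; exact Nat.choose_pos hmn)
    (fun C hC => by rw [hcard]; exact hlaw C (Finset.mem_powersetCard.1 hC).2) b
  rwa [hcard] at h

end Independence

/-! ### The assumptions in the form used by the analysis -/

/-- The regularity of the clients' functions that is used by the method: `f` is the objective,
bounded below by `fmin`, `f₁` is the function of the delegate client, and the `G i` are the gradients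
of the clients. -/
structure SimilarClients {n : ℕ} [NeZero n] {E : Type} [NormedAddCommGroup E]
    [InnerProductSpace ℝ E] (f f₁ : E → ℝ) (G : Fin n → E → E) (Δ δ L fmin : ℝ) : Prop where
  continuous_f : Continuous f
  continuous_f₁ : Continuous f₁
  continuous_G : ∀ i, Continuous (G i)
  lipschitz : ∀ x y, ‖G 0 x - G 0 y‖ ≤ L * ‖x - y‖
  similarity₁ : ∀ x y, ‖(fullMean G x - G 0 x) - (fullMean G y - G 0 y)‖ ≤ Δ * ‖x - y‖
  similarity : ∀ x y, (1 / (n : ℝ)) *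
    ∑ i, ‖(fullMean G x - G i x) - (fullMean G y - G i y)‖ ^ 2 ≤ δ ^ 2 * ‖x - y‖ ^ 2
  descent₁ : ∀ x y, f₁ y ≤ f₁ x + ⟪G 0 x, y - x⟫ + L / 2 * ‖y - x‖ ^ 2
  descent : ∀ x y, f y - f₁ y ≤
    f x - f₁ x + ⟪fullMean G x - G 0 x, y - x⟫ + Δ / 2 * ‖y - x‖ ^ 2
  le_f : ∀ x, fmin ≤ f x

/-! ### Mean square error of the gradient estimator -/

section Estimator

variable {n m : ℕ} {E : Type} [NormedAddCommGroup E] [InnerProductSpace ℝ E]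

/-- Every index lies in equally many samples. This unbiasedness removes the cross term from the
estimator's mean square error. -/
theorem sum_powersetCard_sum {n m : ℕ} {E : Type*} [AddCommGroup E] (hm : 1 ≤ m) (v : Fin n → E) (hv : ∑ i, v i = 0) :
    ∑ C ∈ (Finset.univ : Finset (Fin n)).powersetCard m, ∑ i ∈ C, v i = 0 := by
  have h1 : ∀ C : Finset (Fin n), ∑ i ∈ C, v i = ∑ i, if i ∈ C then v i else 0 := by
    intro C
    simp
  simp_rw [h1]
  rw [Finset.sum_comm]
  have h2 : ∀ i, ∑ C ∈ (Finset.univ : Finset (Fin n)).powersetCard m,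
      (if i ∈ C then v i else 0) = (n - 1).choose (m - 1) • v i := by
    intro i
    have := Finset.card_filter_powersetCard_subset {i} (Finset.univ : Finset (Fin n)) m
      (Finset.subset_univ _) (by simpa using hm)
    simp only [Finset.singleton_subset_iff, Finset.card_univ, Fintype.card_fin,
      Finset.card_singleton] at this
    rw [← Finset.sum_filter, Finset.sum_const, this]
  simp_rw [h2]
  rw [← Finset.smul_sum, hv, smul_zero]

theorem sum_fullMean_sub [NeZero n] (G : Fin n → E → E) (x : E) :
    ∑ i, (fullMean G x - G i x) = 0 := by
  have hn : (n : ℝ) ≠ 0 := Nat.cast_ne_zero.2 (NeZero.ne n)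
  rw [Finset.sum_sub_distrib, Finset.sum_const, Finset.card_univ, Fintype.card_fin, fullMean,
    ← Nat.cast_smul_eq_nsmul ℝ, smul_smul, mul_one_div_cancel hn, one_smul, sub_self]

theorem deltaM_sq (hm : 1 ≤ m) (hmn : m ≤ n) (δ : ℝ) :
    deltaM n m δ ^ 2 = (((n : ℝ) - m) / ((n : ℝ) - 1)) / m * δ ^ 2 := by
  have h1 : (1 : ℝ) ≤ m := by exact_mod_cast hm
  have h2 : (m : ℝ) ≤ n := by exact_mod_cast hmn
  rw [deltaM, mul_pow, Real.sq_sqrt]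
  exact div_nonneg (div_nonneg (by linarith) (by linarith)) (by linarith)

/-- The mean square error of the RG-SVRG estimator after one step. -/
theorem sum_norm_sq_nextEstimate_le [NeZero n] (hm : 1 ≤ m) (hmn : m ≤ n) {f f₁ : E → ℝ}
    {G : Fin n → E → E} {Δ δ L fmin : ℝ} (h : SimilarClients f f₁ G Δ δ L fmin) (β : ℝ)
    (x g w x' : E) :
    ∑ C ∈ (Finset.univ : Finset (Fin n)).powersetCard m, 1 / (n.choose m : ℝ) *
        ‖fullMean G x' - nextEstimate m G β C x g w x'‖ ^ 2 ≤
      (1 - β) ^ 2 * ‖fullMean G x - g‖ ^ 2 +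
        deltaM n m δ ^ 2 * (2 * β ^ 2 * ‖x - w‖ ^ 2 + 2 * ‖x' - x‖ ^ 2) := by
  obtain ⟨r, hr⟩ : ∃ r : E → Fin n → E, ∀ z i, r z i = fullMean G z - G i z :=
    ⟨_, fun _ _ => rfl⟩
  have hr0 : ∀ z, ∑ i, r z i = 0 := fun z => by simp_rw [hr, sum_fullMean_sub]
  set a : Fin n → E := fun i => r x i - r w i with ha
  set b : Fin n → E := fun i => r x' i - r x i with hb
  set v : Fin n → E := fun i => β • a i + b i with hvdef
  set A := (1 - β) • (fullMean G x - g) with hA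
  have hm0 : (m : ℝ) ≠ 0 := by
    have : m ≠ 0 := by omega
    exact_mod_cast this
  have hc : (n.choose m : ℝ) ≠ 0 := by exact_mod_cast (Nat.choose_pos hmn).ne'
  have hv : ∑ i, v i = 0 := by
    simp only [hvdef, ha, hb, Finset.sum_add_distrib, ← Finset.smul_sum]
    rw [Finset.sum_sub_distrib, Finset.sum_sub_distrib, hr0, hr0, hr0]
    simp
  -- The error is the old error times `1 - β` plus a centred sample mean of β(∇hᵢ(x) − ∇hᵢ(w)) +
  -- (∇hᵢ(x') − ∇hᵢ(x)). The sample size must be exactly `m` for the full gradients to match.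
  have hdec : ∀ C ∈ (Finset.univ : Finset (Fin n)).powersetCard m,
      fullMean G x' - nextEstimate m G β C x g w x' = A + (1 / (m : ℝ)) • ∑ i ∈ C, v i := by
    intro C hC
    have hcard : C.card = m := (Finset.mem_powersetCard.1 hC).2
    have hs : ∀ z, (1 / (m : ℝ)) • ∑ i ∈ C, r z i =
        fullMean G z - sampleMean m G C z := by
      intro z
      simp_rw [hr]
      rw [Finset.sum_sub_distrib, Finset.sum_const, hcard, smul_sub, ← Nat.cast_smul_eq_nsmul ℝ,
        smul_smul, one_div_mul_cancel hm0, one_smul, sampleMean]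
    simp only [hvdef, ha, hb, Finset.sum_add_distrib, ← Finset.smul_sum]
    rw [Finset.sum_sub_distrib, Finset.sum_sub_distrib, smul_add, smul_comm, smul_sub, smul_sub,
      smul_sub, hs, hs, hs, hA, nextEstimate]
    module
  have hsq : ∀ C ∈ (Finset.univ : Finset (Fin n)).powersetCard m, 1 / (n.choose m : ℝ) *
        ‖fullMean G x' - nextEstimate m G β C x g w x'‖ ^ 2 =
      1 / (n.choose m : ℝ) * ‖A‖ ^ 2 + 2 * (1 / (n.choose m : ℝ)) * (1 / (m : ℝ)) *
        ⟪A, ∑ i ∈ C, v i⟫ + 1 / (n.choose m : ℝ) * ‖(1 / (m : ℝ)) • ∑ i ∈ C, v i‖ ^ 2 := by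
    intro C hC
    rw [hdec C hC, norm_add_sq_real, real_inner_smul_right]
    ring
  rw [Finset.sum_congr rfl hsq, Finset.sum_add_distrib, Finset.sum_add_distrib, ← Finset.mul_sum,
    ← Finset.mul_sum, ← inner_sum, sum_powersetCard_sum hm v hv, inner_zero_right, mul_zero, add_zero,
    Finset.sum_const, Finset.card_powersetCard, Finset.card_univ, Fintype.card_fin, nsmul_eq_mul,
    ← mul_assoc, one_div_mul_cancel hc, one_mul, sum_powersetCard_norm_sq_mean hm hmn v hv,
    deltaM_sq hm hmn, hA, norm_smul, mul_pow, Real.norm_eq_abs, sq_abs, mul_assoc]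
  have hq : 0 ≤ (((n : ℝ) - m) / ((n : ℝ) - 1)) / m := by
    have h1 : (1 : ℝ) ≤ m := by exact_mod_cast hm
    have h2 : (m : ℝ) ≤ n := by exact_mod_cast hmn
    exact div_nonneg (div_nonneg (by linarith) (by linarith)) (by linarith)
  have hn0 : 0 ≤ 1 / (n : ℝ) := by positivity
  have hvi : ∀ i, ‖v i‖ ^ 2 ≤ 2 * β ^ 2 * ‖a i‖ ^ 2 + 2 * ‖b i‖ ^ 2 := by
    intro i
    have h1 : ‖v i‖ ^ 2 ≤ (‖β • a i‖ + ‖b i‖) ^ 2 := by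
      gcongr
      exact norm_add_le _ _
    have h2 : ‖β • a i‖ ^ 2 = β ^ 2 * ‖a i‖ ^ 2 := by
      rw [norm_smul, mul_pow, Real.norm_eq_abs, sq_abs]
    nlinarith [sq_nonneg (‖β • a i‖ - ‖b i‖)]
  have hsum : 1 / (n : ℝ) * ∑ i, ‖v i‖ ^ 2 ≤
      δ ^ 2 * (2 * β ^ 2 * ‖x - w‖ ^ 2 + 2 * ‖x' - x‖ ^ 2) := by
    calc 1 / (n : ℝ) * ∑ i, ‖v i‖ ^ 2
        ≤ 1 / (n : ℝ) * ∑ i, (2 * β ^ 2 * ‖a i‖ ^ 2 + 2 * ‖b i‖ ^ 2) := by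
          gcongr with i
          exact hvi i
      _ = 2 * β ^ 2 * (1 / (n : ℝ) * ∑ i, ‖a i‖ ^ 2) + 2 * (1 / (n : ℝ) * ∑ i, ‖b i‖ ^ 2) := by
          rw [Finset.sum_add_distrib, ← Finset.mul_sum, ← Finset.mul_sum]
          ring
      _ ≤ 2 * β ^ 2 * (δ ^ 2 * ‖x - w‖ ^ 2) + 2 * (δ ^ 2 * ‖x' - x‖ ^ 2) := by
          have h1 := h.similarity x w
          have h2 := h.similarity x' x
          simp only [← hr] at h1 h2
          exact add_le_add (mul_le_mul_of_nonneg_left h1 (by positivity))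
            (mul_le_mul_of_nonneg_left h2 zero_le_two)
      _ = _ := by ring
  gcongr

end Estimator

/-! ### Continuity of one iteration in the state -/

section Continuity

variable {n m : ℕ} {E : Type} [NormedAddCommGroup E] [InnerProductSpace ℝ E]
  {G : Fin n → E → E} {L lam : ℝ}

theorem continuous_fullMean (h : ∀ i, Continuous (G i)) : Continuous (fullMean G) :=
  (continuous_finsetSum _ fun i _ => h i).const_smul _

theorem continuous_sampleMean (h : ∀ i, Continuous (G i)) (C : Finset (Fin n)) :
    Continuous (sampleMean m G C) :=
  (continuous_finsetSum _ fun i _ => h i).const_smul _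

theorem continuous_iterate_cgmMap {G : E → E} (h : Continuous G) (k : ℕ) :
    Continuous fun s : E × E × E => (cgmMap G L lam s.1 s.2.1)^[k] s.1 := by
  induction k with
  | zero => exact continuous_fst
  | succ k ih =>
    simp only [Function.iterate_succ_apply']
    simp only [cgmMap, cgmStep] at ih ⊢
    fun_prop

theorem continuous_nextEstimate (h : ∀ i, Continuous (G i)) (β : ℝ) (C : Finset (Fin n)) :
    Continuous fun q : (E × E × E) × E => nextEstimate m G β C q.1.1 q.1.2.1 q.1.2.2 q.2 := by
  have h1 := continuous_fullMean h
  have h2 := continuous_sampleMean (m := m) h C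
  simp only [nextEstimate]
  fun_prop

theorem continuous_nextState [NeZero n] (h : ∀ i, Continuous (G i)) (β : ℝ) (k : ℕ) (C : Finset (Fin n))
    (b : Bool) : Continuous (nextState m G L lam β k C b) := by
  have h1 := continuous_iterate_cgmMap (L := L) (lam := lam) (h 0) (k + 1)
  refine h1.prodMk (Continuous.prodMk ?_ ?_)
  · exact (continuous_nextEstimate h β C).comp (continuous_id.prodMk h1)
  · cases b
    · exact continuous_snd.comp continuous_snd
    · exact h1

end Continuity

/-! ### Bounds uniform in the draws, and the expected local progress -/

section Bounded

variable {n m : ℕ} [NeZero n] {E : Type} [NormedAddCommGroup E] [InnerProductSpace ℝ E]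
  {f f₁ : E → ℝ} {G : Fin n → E → E} {Δ δ L fmin lam : ℝ} [ProperSpace E]

/-- The model never exceeds its value at the centre, so the distance to the centre is controlled by
`f x - fmin` and `‖F x - g‖`, whatever `k` is; compactness bounds both over the ball. -/
theorem exists_norm_iterate_le (h : SimilarClients f f₁ G Δ δ L fmin) (hs : 0 < lam + L)
    (ha : 0 < lam - Δ) (R : ℝ) :
    ∃ R', R ≤ R' ∧ ∀ s : E × E × E, ‖s‖ ≤ R → ∀ k,
      ‖(cgmMap (G 0) L lam s.1 s.2.1)^[k] s.1‖ ≤ R' := by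
  have hF := continuous_fullMean h.continuous_G
  have hf := h.continuous_f
  have hcont : Continuous fun s : E × E × E =>
      4 / (lam - Δ) * (f s.1 - fmin + ‖fullMean G s.1 - s.2.1‖ ^ 2 / (lam - Δ)) := by fun_prop
  obtain ⟨M, hM⟩ := (isCompact_closedBall (0 : E × E × E) R).exists_bound_of_continuousOn
    hcont.continuousOn
  refine ⟨R + √M, by linarith [Real.sqrt_nonneg M], fun s hsR k => ?_⟩
  set z := (cgmMap (G 0) L lam s.1 s.2.1)^[k] s.1
  have h1 := norm_sq_le_of_cgmModel_le ha h.descent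
    (cgmModel_iterate_le hs h.descent₁ s.1 s.2.1 k)
  have h2 := (Real.le_norm_self _).trans (hM s (by simpa using hsR))
  have h3 : ‖z - s.1‖ ^ 2 ≤ M := by
    refine le_trans ?_ h2
    calc ‖z - s.1‖ ^ 2 = 4 / (lam - Δ) * ((lam - Δ) / 4 * ‖z - s.1‖ ^ 2) := by field_simp
      _ ≤ _ := by
        gcongr
        linarith [h.le_f z]
  have h4 : ‖z - s.1‖ ≤ √M := Real.le_sqrt_of_sq_le h3
  calc ‖z‖ = ‖s.1 + (z - s.1)‖ := by rw [add_sub_cancel]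
    _ ≤ ‖s.1‖ + ‖z - s.1‖ := norm_add_le _ _
    _ ≤ _ := add_le_add ((norm_fst_le s).trans hsR) h4

/-- The radius may depend on `t` but not on the draws: the number of local steps is handled by the
preceding lemma, and there are only finitely many samples. No moment estimates are needed for
integrability. -/
theorem exists_norm_iterState_le (h : SimilarClients f f₁ G Δ δ L fmin) (hs : 0 < lam + L)
    (ha : 0 < lam - Δ) (β : ℝ) (x₀ : E) (t : ℕ) :
    ∃ R, ∀ K S coin, ‖iterState m G L lam β x₀ K S coin t‖ ≤ R := by
  induction t with
  | zero => exact ⟨‖((x₀, fullMean G x₀, x₀) : E × E × E)‖, fun _ _ _ => le_rfl⟩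
  | succ t ih =>
    obtain ⟨R, hR⟩ := ih
    obtain ⟨R', hRR', hR'⟩ := exists_norm_iterate_le h hs ha R
    have hcont : Continuous fun q : (E × E × E) × E => ∑ C : Finset (Fin n),
        ‖nextEstimate m G β C q.1.1 q.1.2.1 q.1.2.2 q.2‖ :=
      continuous_finsetSum _ fun C _ => (continuous_nextEstimate h.continuous_G β C).norm
    obtain ⟨M, hM⟩ := (isCompact_closedBall (0 : (E × E × E) × E) R').exists_bound_of_continuousOn
      hcont.continuousOn
    refine ⟨max R' M, fun K S coin => ?_⟩
    rw [iterState]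
    set s := iterState m G L lam β x₀ K S coin t with hsdef
    have hsR := hR K S coin
    rw [← hsdef] at hsR
    have hx := hR' s hsR (K t + 1)
    simp only [nextState]
    set x' := (cgmMap (G 0) L lam s.1 s.2.1)^[K t + 1] s.1
    have hq := hM (s, x') (mem_closedBall_zero_iff.2 (max_le (hsR.trans hRR') hx))
    have hg : ‖nextEstimate m G β (S t) s.1 s.2.1 s.2.2 x'‖ ≤ M := by
      refine le_trans ?_ ((Real.le_norm_self _).trans hq)
      exact Finset.single_le_sum
        (f := fun C => ‖nextEstimate m G β C s.1 s.2.1 s.2.2 x'‖)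
        (fun C _ => norm_nonneg _) (Finset.mem_univ (S t))
    have hw : ‖if coin (t + 1) = true then x' else s.2.2‖ ≤ R' := by
      split_ifs
      · exact hx
      · exact ((norm_snd_le s.2).trans (norm_snd_le s)).trans (hsR.trans hRR')
    rw [Prod.norm_def, Prod.norm_def]
    exact max_le (hx.trans (le_max_left _ _))
      (max_le (hg.trans (le_max_right _ _)) (hw.trans (le_max_left _ _)))

/-- The expected decrease of the potential in one call of the local method. -/
theorem integral_potential_le (h : SimilarClients f f₁ G Δ δ L fmin) (hΔ : 0 ≤ Δ) (hL : 0 < L)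
    (hlam : 3 * Δ ≤ lam) (ha : 0 < lam - Δ) {p : ℝ} (hp : p = (lam - Δ) / (8 * (L + lam)))
    {Ω : Type*} {mΩ : MeasurableSpace Ω} {μ : Measure Ω} [IsProbabilityMeasure μ] {Y : Ω → ℕ}
    (hY : Measurable[mΩ, ⊤] Y)
    (hlaw : ∀ k, μ {ω | Y ω = k} = ENNReal.ofReal ((1 - p) ^ k * p)) (s : E × E × E) :
    ∫ ω, (fun z => ‖fullMean G z‖ ^ 2 + 64 * (lam - Δ) * f z +
        4 * (lam - Δ) ^ 2 * ‖z - s.1‖ ^ 2) ((cgmMap (G 0) L lam s.1 s.2.1)^[Y ω + 1] s.1) ∂μ ≤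
      67 * ‖fullMean G s.1 - s.2.1‖ ^ 2 + 64 * (lam - Δ) * f s.1 := by
  have hs : 0 < lam + L := by linarith
  have hp0 : 0 < p := by rw [hp]; exact div_pos ha (by linarith)
  have hp1 : p < 1 := by
    rw [hp, div_lt_one (by linarith)]
    linarith
  have hF := continuous_fullMean h.continuous_G
  have hf := h.continuous_f
  have hf₁ := h.continuous_f₁
  obtain ⟨R', -, hR'⟩ := exists_norm_iterate_le h hs ha ‖s‖
  set y : ℕ → E := fun k => (cgmMap (G 0) L lam s.1 s.2.1)^[k] s.1 with hy
  have hbdd : ∀ φ : E → ℝ, Continuous φ → ∃ B, ∀ k, |φ (y k)| ≤ B := by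
    intro φ hφ
    obtain ⟨B, hB⟩ := (isCompact_closedBall (0 : E) R').exists_bound_of_continuousOn
      hφ.continuousOn
    exact ⟨B, fun k => hB _ (by simpa using hR' s le_rfl k)⟩
  have hmodel : Continuous (cgmModel f₁ (G 0) lam s.1 s.2.1) := by
    unfold cgmModel
    fun_prop
  -- The total decrease of the model after `k` steps. It vanishes at 0, as the geometric shift
  -- formula requires.
  set b : ℕ → ℝ := fun k => cgmModel f₁ (G 0) lam s.1 s.2.1 s.1 -
    cgmModel f₁ (G 0) lam s.1 s.2.1 (y k) with hb
  obtain ⟨B₁, hB₁⟩ := hbdd (fun z => cgmModel f₁ (G 0) lam s.1 s.2.1 s.1 -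
    cgmModel f₁ (G 0) lam s.1 s.2.1 z) (continuous_const.sub hmodel)
  obtain ⟨B₂, hB₂⟩ := hbdd (fun z => ‖fullMean G z‖ ^ 2 + 64 * (lam - Δ) * f z +
        4 * (lam - Δ) ^ 2 * ‖z - s.1‖ ^ 2) (by fun_prop)
  have hi1 : Integrable (fun ω => b (Y ω)) μ := integrable_comp_of_bounded hY hB₁
  have hi2 : Integrable (fun ω => b (Y ω + 1)) μ :=
    integrable_comp_of_bounded (b := fun k => b (k + 1)) hY fun k => hB₁ (k + 1)
  have hshift : ∫ ω, b (Y ω) ∂μ = (1 - p) * ∫ ω, b (Y ω + 1) ∂μ :=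
    integral_geometric_shift (b := b) hp0 hp1 hY hlaw hB₁ (by simp [b, y])
  have hb0 : 0 ≤ ∫ ω, b (Y ω + 1) ∂μ :=
    integral_nonneg fun ω => sub_nonneg.2 (cgmModel_iterate_le hs h.descent₁ s.1 s.2.1 _)
  set c := 24 * L ^ 2 / (L + lam) with hc
  have hI : Integrable (fun ω => (c - 64 * (lam - Δ)) * b (Y ω + 1) - c * b (Y ω)) μ :=
    (hi2.const_mul _).sub (hi1.const_mul _)
  calc _ ≤ ∫ ω, ((67 * ‖fullMean G s.1 - s.2.1‖ ^ 2 + 64 * (lam - Δ) * f s.1) +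
        ((c - 64 * (lam - Δ)) * b (Y ω + 1) - c * b (Y ω))) ∂μ := by
        refine integral_mono
          (integrable_comp_of_bounded (b := fun k => (fun z => ‖fullMean G z‖ ^ 2 +
            64 * (lam - Δ) * f z + 4 * (lam - Δ) ^ 2 * ‖z - s.1‖ ^ 2) (y (k + 1))) hY
            fun k => hB₂ (k + 1))
          ((integrable_const _).add hI) fun ω => ?_
        have := potential_cgmMap_le hΔ hL hlam ha h.lipschitz h.similarity₁ h.descent₁ h.descent
          s.1 s.2.1 (y (Y ω)) (y (Y ω + 1)) (Function.iterate_succ_apply' _ _ _)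
        simp only [hb]
        linarith
    _ = 67 * ‖fullMean G s.1 - s.2.1‖ ^ 2 + 64 * (lam - Δ) * f s.1 +
        (c * p - 64 * (lam - Δ)) * ∫ ω, b (Y ω + 1) ∂μ := by
        rw [integral_add (integrable_const _) hI,
          integral_sub (hi2.const_mul _) (hi1.const_mul _), integral_const_mul,
          integral_const_mul, hshift, integral_const, probReal_univ, one_smul]
        ring
    _ ≤ _ := by
        -- This is what `p` is chosen for: the last step's share of the decrease costs at most 3(lam
        -- − Δ), out of the 64(lam − Δ) available.
        have hcp : c * p ≤ 3 * (lam - Δ) := by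
          have e : c * p = 3 * (lam - Δ) * (L ^ 2 / (L + lam) ^ 2) := by
            rw [hc, hp]
            have : L + lam ≠ 0 := by linarith
            field_simp
            ring
          have h1 : L ^ 2 / (L + lam) ^ 2 ≤ 1 := by
            rw [div_le_one (pow_pos (by linarith) 2)]
            gcongr
            linarith
          rw [e]
          nlinarith
        nlinarith

end Bounded

/-! ### Measurability with discrete parameters -/

section Discrete

variable {Ω α γ ι κ : Type*} [Countable ι] [Countable κ] {m₁ : MeasurableSpace Ω}
  [MeasurableSpace α] [MeasurableSpace γ]

theorem measurable_apply_discrete {X : Ω → α} (hX : Measurable X) {Y : Ω → ι}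
    (hY : Measurable[m₁, ⊤] Y) {Φ : ι → α → γ} (hΦ : ∀ k, Measurable (Φ k)) :
    Measurable fun ω => Φ (Y ω) (X ω) := by
  let _ : MeasurableSpace ι := ⊤
  have h : Measurable (Function.uncurry Φ) := measurable_from_prod_countable_right hΦ
  exact h.comp (hY.prodMk hX)

theorem measurable_prodMk_discrete {Y : Ω → ι} {Z : Ω → κ} (hY : Measurable[m₁, ⊤] Y)
    (hZ : Measurable[m₁, ⊤] Z) : Measurable[m₁, ⊤] fun ω => (Y ω, Z ω) := by
  let _ : MeasurableSpace (ι × κ) := ⊤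
  refine measurable_to_countable' fun q => ?_
  have e : (fun ω => (Y ω, Z ω)) ⁻¹' {q} = Y ⁻¹' {q.1} ∩ Z ⁻¹' {q.2} := by
    ext ω
    simp [Prod.ext_iff]
  rw [e]
  exact (hY trivial).inter (hZ trivial)

end Discrete

/-! ### The Lyapunov function and its recursion -/

section Lyapunov

variable {n m : ℕ} [NeZero n] {E : Type} [NormedAddCommGroup E] [InnerProductSpace ℝ E]

/-- The Lyapunov function of the method. -/
def lyapunov {n : ℕ} {E : Type} [NormedAddCommGroup E] [InnerProductSpace ℝ E] (m : ℕ)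
    (f : E → ℝ) (G : Fin n → E → E) (a δ pB : ℝ)
    (s : E × E × E) : ℝ :=
  64 * a * f s.1 + 134 / pB * ‖fullMean G s.1 - s.2.1‖ ^ 2 +
    134 * deltaM n m δ ^ 2 * ‖s.1 - s.2.2‖ ^ 2

theorem continuous_lyapunov {f f₁ : E → ℝ} {G : Fin n → E → E} {Δ δ L fmin : ℝ}
    (h : SimilarClients f f₁ G Δ δ L fmin) (a pB : ℝ) :
    Continuous (lyapunov m f G a δ pB) := by
  have hF := continuous_fullMean h.continuous_G
  have hf := h.continuous_f
  unfold lyapunov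
  fun_prop

end Lyapunov

/-- One step of the Lyapunov recursion, in terms of expectations. -/
theorem lyapunov_step_real {a D pB E₁ f₀ f₁ r e e' d d' : ℝ} (hpB : 0 < pB) (hpB1 : pB ≤ 1)
    (ha : 484 * D / pB ≤ a ^ 2) (hD : 0 ≤ D) (hr : 0 ≤ r) (he : 0 ≤ e) (hd : 0 ≤ d)
    (h1 : E₁ + 64 * a * f₁ + 4 * a ^ 2 * r ≤ 67 * e + 64 * a * f₀)
    (h2 : e' ≤ (1 - pB / 2) ^ 2 * e + D * (2 * (pB / 2) ^ 2 * d + 2 * r))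
    (h3 : d' ≤ (1 - pB) * ((1 + pB / 2) * d + (1 + 2 / pB) * r)) :
    E₁ + (64 * a * f₁ + 134 / pB * e' + 134 * D * d') ≤
      64 * a * f₀ + 134 / pB * e + 134 * D * d := by
  have i2 := mul_le_mul_of_nonneg_left h2 (by positivity : 0 ≤ 134 / pB)
  have i3 := mul_le_mul_of_nonneg_left h3 (by positivity : 0 ≤ 134 * D)
  -- The weight 134 / pB turns the contraction of `e` into −134 e + (67/2) pB e, enough for the 67 e
  -- of `h1`. The terms ±67 pB (D d) of `j1` and `j2` cancel.
  have j1 : 134 / pB * ((1 - pB / 2) ^ 2 * e + D * (2 * (pB / 2) ^ 2 * d + 2 * r)) =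
      134 / pB * e - 134 * e + 67 / 2 * pB * e + 67 * pB * (D * d) + 268 * (D / pB) * r := by
    field_simp
    ring
  have j2 : 134 * D * ((1 - pB) * ((1 + pB / 2) * d + (1 + 2 / pB) * r)) =
      134 * D * d - 67 * pB * (D * d) - 67 * pB ^ 2 * (D * d) + 268 * (D / pB) * r -
        134 * (1 + pB) * (D * r) := by
    field_simp
    ring
  -- Both errors together produce at most 536 (D / pB) r, while 4a² r supplies 4 · 484.
  have j3 : 484 * (D / pB) * r ≤ a ^ 2 * r := by
    rw [← mul_div_assoc]
    gcongr
  have k1 : pB * e ≤ e := mul_le_of_le_one_left he hpB1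
  have k2 : 0 ≤ pB ^ 2 * (D * d) := by positivity
  have k3 : 0 ≤ (1 + pB) * (D * r) := by positivity
  have k4 : 0 ≤ D / pB * r := by positivity
  linarith

/-! ### The filtration of the draws, and the summed gradient bound -/

section Past

variable {Ω : Type*} {n : ℕ}

/-- The σ-algebras that are generated by the individual random variables of the method. -/
@[reducible]
def sigmaOf (K : ℕ → Ω → ℕ) (S : ℕ → Ω → Finset (Fin n)) (coin : ℕ → Ω → Bool) (τ : Ω → ℕ) :
    ℕ ⊕ ℕ ⊕ ℕ ⊕ Unit → MeasurableSpace Ω :=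
  Sum.elim (fun t : ℕ => MeasurableSpace.comap (K t) ⊤)
    (Sum.elim (fun t : ℕ => MeasurableSpace.comap (S t) ⊤)
      (Sum.elim (fun t : ℕ => MeasurableSpace.comap (coin t) ⊤)
        (fun _ : Unit => MeasurableSpace.comap τ ⊤)))

/-- The indices of the random variables that determine `(xᵗ, gᵗ, wᵗ)`. -/
def pastIndices (t : ℕ) : Set (ℕ ⊕ ℕ ⊕ ℕ ⊕ Unit) :=
  -- The coin with index `t` belongs to the past, since it decides wᵗ; `K t` and `S t` enter only in
  -- iteration `t`.
  {i | Sum.elim (· < t) (Sum.elim (· < t) (Sum.elim (· ≤ t) fun _ => False)) i}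

theorem pastIndices_mono {s t : ℕ} (h : s ≤ t) : pastIndices s ⊆ pastIndices t := by
  rintro (i | i | i | i) hi
  · exact lt_of_lt_of_le (b := s) hi h
  · exact lt_of_lt_of_le (b := s) hi h
  · exact le_trans (b := s) hi h
  · exact hi

variable (K : ℕ → Ω → ℕ) (S : ℕ → Ω → Finset (Fin n)) (coin : ℕ → Ω → Bool) (τ : Ω → ℕ)

/-- The σ-algebra generated by the random variables with indices in `I`. -/
@[reducible]
def sigmaOn (I : Set (ℕ ⊕ ℕ ⊕ ℕ ⊕ Unit)) : MeasurableSpace Ω :=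
  ⨆ i ∈ I, sigmaOf K S coin τ i

variable {K S coin τ}

theorem sigmaOn_mono {I J : Set (ℕ ⊕ ℕ ⊕ ℕ ⊕ Unit)} (h : I ⊆ J) :
    sigmaOn K S coin τ I ≤ sigmaOn K S coin τ J :=
  biSup_mono h

theorem sigmaOf_le_sigmaOn {I : Set (ℕ ⊕ ℕ ⊕ ℕ ⊕ Unit)} {i : ℕ ⊕ ℕ ⊕ ℕ ⊕ Unit} (h : i ∈ I) :
    sigmaOf K S coin τ i ≤ sigmaOn K S coin τ I :=
  le_iSup₂_of_le (f := fun i _ => sigmaOf K S coin τ i) i h le_rfl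

variable {mΩ : MeasurableSpace Ω} {μ : Measure Ω} {m T : ℕ} {p pB : ℝ}

theorem IsRandomness.sigmaOf_le (h : IsRandomness μ n m T p pB K S coin τ)
    (i : ℕ ⊕ ℕ ⊕ ℕ ⊕ Unit) : sigmaOf K S coin τ i ≤ mΩ := by
  rcases i with t | t | t | _
  · exact (h.measurable_K t).comap_le
  · exact (h.measurable_S t).comap_le
  · exact (h.measurable_coin t).comap_le
  · exact h.measurable_τ.comap_le

theorem IsRandomness.sigmaOn_le (h : IsRandomness μ n m T p pB K S coin τ)
    (I : Set (ℕ ⊕ ℕ ⊕ ℕ ⊕ Unit)) : sigmaOn K S coin τ I ≤ mΩ :=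
  iSup₂_le fun i _ => h.sigmaOf_le i

theorem IsRandomness.indep_comap (h : IsRandomness μ n m T p pB K S coin τ)
    {α : Type*} [mα : MeasurableSpace α] {X : Ω → α} {I : Set (ℕ ⊕ ℕ ⊕ ℕ ⊕ Unit)}
    (hX : Measurable[sigmaOn K S coin τ I] X) {j : ℕ ⊕ ℕ ⊕ ℕ ⊕ Unit} (hj : j ∉ I) :
    Indep (MeasurableSpace.comap X mα) (sigmaOf K S coin τ j) μ := by
  have h1 := indep_iSup_of_disjoint (m := sigmaOf K S coin τ) h.sigmaOf_le h.indep
    (S := I) (T := {j}) (Set.disjoint_singleton_right.2 hj)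
  rw [iSup_singleton] at h1
  exact indep_of_indep_of_le_left h1 hX.comap_le

variable [NeZero n] {E : Type} [NormedAddCommGroup E] [InnerProductSpace ℝ E] [ProperSpace E]
  [MeasurableSpace E] [BorelSpace E]

/-- The random triple `(xᵗ, gᵗ, wᵗ)`. -/
def randState (m : ℕ) (G : Fin n → E → E) (L lam β : ℝ) (x₀ : E) (K : ℕ → Ω → ℕ)
    (S : ℕ → Ω → Finset (Fin n)) (coin : ℕ → Ω → Bool) (t : ℕ) (ω : Ω) : E × E × E :=
  iterState m G L lam β x₀ (fun t => K t ω) (fun t => S t ω) (fun t => coin t ω) t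

variable {G : Fin n → E → E} {L lam β : ℝ} {x₀ : E}

/-- Measurability for the σ-algebra of the variables used so far, and not merely for the ambient
one, is what makes the next draw independent of the state. -/
theorem measurable_randState (hG : ∀ i, Continuous (G i)) (τ : Ω → ℕ) (t : ℕ) :
    Measurable[sigmaOn K S coin τ (pastIndices t)] (randState m G L lam β x₀ K S coin t) := by
  induction t with
  | zero => exact @measurable_const _ _ _ (sigmaOn K S coin τ (pastIndices 0)) _
  | succ t ih =>
    let m₁ := sigmaOn K S coin τ (pastIndices (t + 1))
    have hX : Measurable[m₁] (randState m G L lam β x₀ K S coin t) :=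
      ih.mono (sigmaOn_mono (pastIndices_mono t.le_succ)) le_rfl
    have hK : Measurable[m₁, ⊤] (K t) := measurable_iff_comap_le.2
      (sigmaOf_le_sigmaOn (i := Sum.inl t) (Nat.lt_succ_self t))
    have hS : Measurable[m₁, ⊤] (S t) := measurable_iff_comap_le.2
      (sigmaOf_le_sigmaOn (i := Sum.inr (Sum.inl t)) (Nat.lt_succ_self t))
    have hc : Measurable[m₁, ⊤] (coin (t + 1)) := measurable_iff_comap_le.2
      (sigmaOf_le_sigmaOn (i := Sum.inr (Sum.inr (Sum.inl (t + 1)))) (le_refl (t + 1)))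
    exact measurable_apply_discrete hX
      (measurable_prodMk_discrete hK (measurable_prodMk_discrete hS hc))
      (Φ := fun q s => nextState m G L lam β q.1 q.2.1 q.2.2 s)
      fun q => (continuous_nextState hG β q.1 q.2.1 q.2.2).measurable

/-- Up to `xᵗ⁺¹`, iteration `t` uses only the past and `K t`. -/
theorem measurable_randState_succ_fst (hG : ∀ i, Continuous (G i)) (τ : Ω → ℕ) (t : ℕ) :
    Measurable[sigmaOn K S coin τ (insert (Sum.inl t) (pastIndices t))] fun ω =>
      (randState m G L lam β x₀ K S coin t ω, (randState m G L lam β x₀ K S coin (t + 1) ω).1) := by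
  let m₁ := sigmaOn K S coin τ (insert (Sum.inl t) (pastIndices t))
  have hX : Measurable[m₁] (randState m G L lam β x₀ K S coin t) :=
    (measurable_randState hG τ t).mono (sigmaOn_mono (Set.subset_insert _ _)) le_rfl
  have hK : Measurable[m₁, ⊤] (K t) := measurable_iff_comap_le.2
    (sigmaOf_le_sigmaOn (i := Sum.inl t) (Set.mem_insert _ _))
  exact hX.prodMk (measurable_apply_discrete hX hK
    (Φ := fun k s => (cgmMap (G 0) L lam s.1 s.2.1)^[k + 1] s.1)
    fun k => (continuous_iterate_cgmMap (hG 0) (k + 1)).measurable)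

variable [IsProbabilityMeasure μ] {f f₁ : E → ℝ} {Δ δ fmin : ℝ}

/-- Both states stay in a compact ball whatever the draws, so a continuous function of them is
bounded. -/
theorem integrable_of_continuous (hr : IsRandomness μ n m T p pB K S coin τ)
    (h : SimilarClients f f₁ G Δ δ L fmin) (hs : 0 < lam + L) (ha : 0 < lam - Δ) (s t : ℕ)
    {φ : (E × E × E) × (E × E × E) → ℝ} (hφ : Continuous φ) :
    Integrable (fun ω => φ (randState m G L lam β x₀ K S coin s ω,
      randState m G L lam β x₀ K S coin t ω)) μ := by
  obtain ⟨R, hR⟩ := exists_norm_iterState_le (m := m) h hs ha β x₀ s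
  obtain ⟨R', hR'⟩ := exists_norm_iterState_le (m := m) h hs ha β x₀ t
  obtain ⟨M, hM⟩ := (isCompact_closedBall (0 : (E × E × E) × (E × E × E))
    (max R R')).exists_bound_of_continuousOn hφ.continuousOn
  have hmeas : ∀ u, Measurable (randState m G L lam β x₀ K S coin u) := fun u =>
    (measurable_randState h.continuous_G τ u).mono (hr.sigmaOn_le _) le_rfl
  refine Integrable.of_bound
    (hφ.measurable.comp ((hmeas s).prodMk (hmeas t))).aestronglyMeasurable M
    (Filter.Eventually.of_forall fun ω => hM _ ?_)
  exact mem_closedBall_zero_iff.2 (max_le_max (hR _ _ _) (hR' _ _ _))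

/-- The draws are averaged one at a time: `K t` against the state at `t`, then `S t` and `coin (t +
1)`, each against that state together with xᵗ⁺¹. The last two never interact, because they affect
different terms of the Lyapunov function. -/
theorem integral_lyapunov_succ_le (hr : IsRandomness μ n m T p pB K S coin τ)
    (h : SimilarClients f f₁ G Δ δ L fmin) (hm : 1 ≤ m) (hmn : m ≤ n) (hΔ : 0 ≤ Δ) (hL : 0 < L)
    (hlam : 3 * Δ ≤ lam) (ha : 0 < lam - Δ) (hp : p = (lam - Δ) / (8 * (L + lam)))
    (hpB : 0 < pB) (hpB1 : pB ≤ 1) (hβ : β = pB / 2)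
    (hδ : 484 * deltaM n m δ ^ 2 / pB ≤ (lam - Δ) ^ 2) (t : ℕ) :
    ∫ ω, ‖fullMean G (randState m G L lam β x₀ K S coin (t + 1) ω).1‖ ^ 2 ∂μ +
      ∫ ω, lyapunov m f G (lam - Δ) δ pB (randState m G L lam β x₀ K S coin (t + 1) ω) ∂μ ≤
    ∫ ω, lyapunov m f G (lam - Δ) δ pB (randState m G L lam β x₀ K S coin t ω) ∂μ := by
  have hs : 0 < lam + L := by linarith
  have hF := continuous_fullMean h.continuous_G
  have hf := h.continuous_f
  set X := randState m G L lam β x₀ K S coin with hX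
  have hint : ∀ {φ : (E × E × E) × (E × E × E) → ℝ}, Continuous φ →
      Integrable (fun ω => φ (X t ω, X (t + 1) ω)) μ := fun hφ =>
    integrable_of_continuous hr h hs ha t (t + 1) hφ
  have hX0 : Measurable (X t) :=
    (measurable_randState h.continuous_G τ t).mono (hr.sigmaOn_le _) le_rfl
  have hX1 := measurable_randState_succ_fst (m := m) (K := K) (S := S) (coin := coin) (L := L)
    (lam := lam) (β := β) (x₀ := x₀) h.continuous_G τ t
  rw [← hX] at hX1
  have iF : Integrable (fun ω => ‖fullMean G (X (t + 1) ω).1‖ ^ 2) μ :=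
    hint (φ := fun q => ‖fullMean G q.2.1‖ ^ 2) (by fun_prop)
  have if0 : Integrable (fun ω => f (X t ω).1) μ := hint (φ := fun q => f q.1.1) (by fun_prop)
  have if1 : Integrable (fun ω => f (X (t + 1) ω).1) μ :=
    hint (φ := fun q => f q.2.1) (by fun_prop)
  have ie0 : Integrable (fun ω => ‖fullMean G (X t ω).1 - (X t ω).2.1‖ ^ 2) μ :=
    hint (φ := fun q => ‖fullMean G q.1.1 - q.1.2.1‖ ^ 2) (by fun_prop)
  have ie1 : Integrable
      (fun ω => ‖fullMean G (X (t + 1) ω).1 - (X (t + 1) ω).2.1‖ ^ 2) μ :=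
    hint (φ := fun q => ‖fullMean G q.2.1 - q.2.2.1‖ ^ 2) (by fun_prop)
  have id0 : Integrable (fun ω => ‖(X t ω).1 - (X t ω).2.2‖ ^ 2) μ :=
    hint (φ := fun q => ‖q.1.1 - q.1.2.2‖ ^ 2) (by fun_prop)
  have id1 : Integrable (fun ω => ‖(X (t + 1) ω).1 - (X (t + 1) ω).2.2‖ ^ 2) μ :=
    hint (φ := fun q => ‖q.2.1 - q.2.2.2‖ ^ 2) (by fun_prop)
  have idm : Integrable (fun ω => ‖(X (t + 1) ω).1 - (X t ω).2.2‖ ^ 2) μ :=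
    hint (φ := fun q => ‖q.2.1 - q.1.2.2‖ ^ 2) (by fun_prop)
  have ir : Integrable (fun ω => ‖(X (t + 1) ω).1 - (X t ω).1‖ ^ 2) μ :=
    hint (φ := fun q => ‖q.2.1 - q.1.1‖ ^ 2) (by fun_prop)
  have hK : ∫ ω, ‖fullMean G (X (t + 1) ω).1‖ ^ 2 ∂μ +
      64 * (lam - Δ) * ∫ ω, f (X (t + 1) ω).1 ∂μ +
      4 * (lam - Δ) ^ 2 * ∫ ω, ‖(X (t + 1) ω).1 - (X t ω).1‖ ^ 2 ∂μ ≤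
      67 * ∫ ω, ‖fullMean G (X t ω).1 - (X t ω).2.1‖ ^ 2 ∂μ +
      64 * (lam - Δ) * ∫ ω, f (X t ω).1 ∂μ := by
    have i1 : Integrable (fun ω => ‖fullMean G (X (t + 1) ω).1‖ ^ 2 +
        64 * (lam - Δ) * f (X (t + 1) ω).1) μ := iF.add (if1.const_mul _)
    have i2 : Integrable (fun ω => 67 * ‖fullMean G (X t ω).1 - (X t ω).2.1‖ ^ 2 +
        64 * (lam - Δ) * f (X t ω).1) μ := (ie0.const_mul _).add (if0.const_mul _)
    have key := integral_le_integral_of_indep hX0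
      (hr.measurable_K t)
      (hr.indep_comap (measurable_randState h.continuous_G τ t) (j := Sum.inl t)
        (fun hlt => lt_irrefl t hlt))
      (φ := fun s k => (fun z => ‖fullMean G z‖ ^ 2 + 64 * (lam - Δ) * f z +
        4 * (lam - Δ) ^ 2 * ‖z - s.1‖ ^ 2) ((cgmMap (G 0) L lam s.1 s.2.1)^[k + 1] s.1))
      (fun k => by
        have := continuous_iterate_cgmMap (L := L) (lam := lam) (h.continuous_G 0) (k + 1)
        refine Continuous.measurable ?_
        fun_prop)
      (i1.add (ir.const_mul _)) i2
      (fun s => integral_potential_le h hΔ hL hlam ha hp (hr.measurable_K t) (hr.law_K t) s)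
    have e1 : ∫ ω, (‖fullMean G (X (t + 1) ω).1‖ ^ 2 + 64 * (lam - Δ) * f (X (t + 1) ω).1 +
        4 * (lam - Δ) ^ 2 * ‖(X (t + 1) ω).1 - (X t ω).1‖ ^ 2) ∂μ ≤ _ := key
    rwa [integral_add i1 (ir.const_mul _), integral_add iF (if1.const_mul _),
      integral_add (ie0.const_mul _) (if0.const_mul _), integral_const_mul, integral_const_mul,
      integral_const_mul, integral_const_mul] at e1
  have hS : ∫ ω, ‖fullMean G (X (t + 1) ω).1 - (X (t + 1) ω).2.1‖ ^ 2 ∂μ ≤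
      (1 - pB / 2) ^ 2 * ∫ ω, ‖fullMean G (X t ω).1 - (X t ω).2.1‖ ^ 2 ∂μ +
      deltaM n m δ ^ 2 * (2 * (pB / 2) ^ 2 * ∫ ω, ‖(X t ω).1 - (X t ω).2.2‖ ^ 2 ∂μ +
        2 * ∫ ω, ‖(X (t + 1) ω).1 - (X t ω).1‖ ^ 2 ∂μ) := by
    have i1 : Integrable (fun ω => 2 * β ^ 2 * ‖(X t ω).1 - (X t ω).2.2‖ ^ 2 +
        2 * ‖(X (t + 1) ω).1 - (X t ω).1‖ ^ 2) μ := (id0.const_mul _).add (ir.const_mul _)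
    have key := integral_le_integral_of_indep (hX1.mono (hr.sigmaOn_le _) le_rfl)
      (hr.measurable_S t)
      (hr.indep_comap hX1 (j := Sum.inr (Sum.inl t)) (by
        rintro (hlt | hlt)
        · cases hlt
        · exact lt_irrefl t hlt))
      (φ := fun q C => ‖fullMean G q.2 - nextEstimate m G β C q.1.1 q.1.2.1 q.1.2.2 q.2‖ ^ 2)
      (ψ := fun q => (1 - β) ^ 2 * ‖fullMean G q.1.1 - q.1.2.1‖ ^ 2 +
        deltaM n m δ ^ 2 * (2 * β ^ 2 * ‖q.1.1 - q.1.2.2‖ ^ 2 + 2 * ‖q.2 - q.1.1‖ ^ 2))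
      (fun C => by
        have := continuous_nextEstimate (m := m) h.continuous_G β C
        refine Continuous.measurable ?_
        fun_prop)
      ie1 ((ie0.const_mul _).add (i1.const_mul _))
      (fun q => by
        rw [integral_uniform_subset hmn (hr.measurable_S t) (hr.law_S t)
          (fun C => ‖fullMean G q.2 - nextEstimate m G β C q.1.1 q.1.2.1 q.1.2.2 q.2‖ ^ 2)]
        exact sum_norm_sq_nextEstimate_le hm hmn h β _ _ _ _)
    refine key.trans_eq ?_
    rw [integral_add (ie0.const_mul _) (i1.const_mul _), integral_const_mul, integral_const_mul,
      integral_add (id0.const_mul _) (ir.const_mul _), integral_const_mul, integral_const_mul, hβ]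
  have hC : ∫ ω, ‖(X (t + 1) ω).1 - (X (t + 1) ω).2.2‖ ^ 2 ∂μ ≤
      (1 - pB) * ((1 + pB / 2) * ∫ ω, ‖(X t ω).1 - (X t ω).2.2‖ ^ 2 ∂μ +
        (1 + 2 / pB) * ∫ ω, ‖(X (t + 1) ω).1 - (X t ω).1‖ ^ 2 ∂μ) := by
    have key := integral_le_integral_of_indep (hX1.mono (hr.sigmaOn_le _) le_rfl)
      (hr.measurable_coin (t + 1))
      (hr.indep_comap hX1 (j := Sum.inr (Sum.inr (Sum.inl (t + 1)))) (by
        rintro (hlt | hlt)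
        · cases hlt
        · exact Nat.not_succ_le_self t hlt))
      (φ := fun q b => ‖q.2 - if b then q.2 else q.1.2.2‖ ^ 2)
      (ψ := fun q => (1 - pB) * ‖q.2 - q.1.2.2‖ ^ 2)
      (fun b => by
        refine Continuous.measurable ?_
        cases b
        · simp only [Bool.false_eq_true, if_false]
          fun_prop
        · simp only [if_true]
          fun_prop)
      id1 (idm.const_mul _)
      (fun q => by
        rw [integral_bernoulli hpB.le (hr.measurable_coin (t + 1)) (hr.law_coin (t + 1))
          (fun b => ‖q.2 - if b then q.2 else q.1.2.2‖ ^ 2)]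
        simp)
    refine key.trans ?_
    rw [integral_const_mul]
    refine mul_le_mul_of_nonneg_left ?_ (by linarith)
    rw [← integral_const_mul, ← integral_const_mul,
      ← integral_add (id0.const_mul _) (ir.const_mul _)]
    refine integral_mono idm ((id0.const_mul _).add (ir.const_mul _)) fun ω => ?_
    set u := (X t ω).1 - (X t ω).2.2
    set v := (X (t + 1) ω).1 - (X t ω).1
    have e : (X (t + 1) ω).1 - (X t ω).2.2 = u + v := by simp only [u, v]; abel
    have h1 : ‖u + v‖ ^ 2 ≤ (‖u‖ + ‖v‖) ^ 2 := by
      gcongr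
      exact norm_add_le _ _
    -- Young's inequality with weight pB / 2, so that (1 − pB)(1 + pB / 2) is still a contraction.
    have h2 : 0 ≤ (pB / 2 * ‖u‖ - ‖v‖) ^ 2 * (2 / pB) := by positivity
    have h3 : (pB / 2 * ‖u‖ - ‖v‖) ^ 2 * (2 / pB) =
        pB / 2 * ‖u‖ ^ 2 + 2 / pB * ‖v‖ ^ 2 - 2 * ‖u‖ * ‖v‖ := by
      field_simp
      ring
    simp only [e]
    linarith
  have hV : ∀ u, Integrable (fun ω => f (X u ω).1) μ →
      Integrable (fun ω => ‖fullMean G (X u ω).1 - (X u ω).2.1‖ ^ 2) μ →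
      Integrable (fun ω => ‖(X u ω).1 - (X u ω).2.2‖ ^ 2) μ →
      ∫ ω, lyapunov m f G (lam - Δ) δ pB (X u ω) ∂μ =
        64 * (lam - Δ) * ∫ ω, f (X u ω).1 ∂μ +
        134 / pB * ∫ ω, ‖fullMean G (X u ω).1 - (X u ω).2.1‖ ^ 2 ∂μ +
        134 * deltaM n m δ ^ 2 * ∫ ω, ‖(X u ω).1 - (X u ω).2.2‖ ^ 2 ∂μ := by
    intro u i1 i2 i3
    have i4 : Integrable (fun ω => 64 * (lam - Δ) * f (X u ω).1 +
      134 / pB * ‖fullMean G (X u ω).1 - (X u ω).2.1‖ ^ 2) μ :=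
      (i1.const_mul _).add (i2.const_mul _)
    simp only [lyapunov]
    rw [integral_add i4 (i3.const_mul _), integral_add (i1.const_mul _) (i2.const_mul _),
      integral_const_mul, integral_const_mul, integral_const_mul]
  rw [hV _ if0 ie0 id0, hV _ if1 ie1 id1]
  exact lyapunov_step_real hpB hpB1 hδ (sq_nonneg _) (integral_nonneg fun _ => sq_nonneg _)
    (integral_nonneg fun _ => sq_nonneg _) (integral_nonneg fun _ => sq_nonneg _) hK hS hC

/-- Telescoping. Both error terms vanish at the start, because the estimate is exact there and the
reference point is `x₀`; at the end they are dropped as nonnegative. -/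
theorem sum_integral_norm_sq_le (hr : IsRandomness μ n m T p pB K S coin τ)
    (h : SimilarClients f f₁ G Δ δ L fmin) (hm : 1 ≤ m) (hmn : m ≤ n) (hΔ : 0 ≤ Δ) (hL : 0 < L)
    (hlam : 3 * Δ ≤ lam) (ha : 0 < lam - Δ) (hp : p = (lam - Δ) / (8 * (L + lam)))
    (hpB : 0 < pB) (hpB1 : pB ≤ 1) (hβ : β = pB / 2)
    (hδ : 484 * deltaM n m δ ^ 2 / pB ≤ (lam - Δ) ^ 2) (r : ℕ) :
    ∑ t ∈ Finset.range r,
      ∫ ω, ‖fullMean G (randState m G L lam β x₀ K S coin (t + 1) ω).1‖ ^ 2 ∂μ ≤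
    64 * (lam - Δ) * (f x₀ - fmin) := by
  have hs : 0 < lam + L := by linarith
  have key : ∀ r, ∑ t ∈ Finset.range r,
      ∫ ω, ‖fullMean G (randState m G L lam β x₀ K S coin (t + 1) ω).1‖ ^ 2 ∂μ +
      ∫ ω, lyapunov m f G (lam - Δ) δ pB (randState m G L lam β x₀ K S coin r ω) ∂μ ≤
      64 * (lam - Δ) * f x₀ := by
    intro r
    induction r with
    | zero => simp [randState, iterState, lyapunov]
    | succ r ih =>
      rw [Finset.sum_range_succ]
      have := integral_lyapunov_succ_le (x₀ := x₀) hr h hm hmn hΔ hL hlam ha hp hpB hpB1 hβ hδ r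
      linarith
  have h1 := key r
  have h2 : 64 * (lam - Δ) * fmin ≤
      ∫ ω, lyapunov m f G (lam - Δ) δ pB (randState m G L lam β x₀ K S coin r ω) ∂μ := by
    have e : 64 * (lam - Δ) * fmin = ∫ _, 64 * (lam - Δ) * fmin ∂μ := by simp
    rw [e]
    have hV := continuous_lyapunov (m := m) h (lam - Δ) pB
    refine integral_mono (integrable_const _)
      (integrable_of_continuous hr h hs ha r r (φ := fun q => lyapunov m f G (lam - Δ) δ pB q.1)
        (by fun_prop)) fun ω => ?_
    have := mul_le_mul_of_nonneg_left (h.le_f (randState m G L lam β x₀ K S coin r ω).1)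
      (by positivity : 0 ≤ 64 * (lam - Δ))
    have h3 : 0 ≤ 134 / pB * ‖fullMean G (randState m G L lam β x₀ K S coin r ω).1 -
      (randState m G L lam β x₀ K S coin r ω).2.1‖ ^ 2 := by positivity
    have h4 : 0 ≤ 134 * deltaM n m δ ^ 2 * ‖(randState m G L lam β x₀ K S coin r ω).1 -
      (randState m G L lam β x₀ K S coin r ω).2.2‖ ^ 2 := by positivity
    simp only [lyapunov]
    linarith
  linarith

end Past

/-! ### The randomly chosen output -/

section Output

variable {Ω : Type*} {mΩ : MeasurableSpace Ω} {μ : Measure Ω} [IsProbabilityMeasure μ]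
  {n m T : ℕ} [NeZero n] {p pB : ℝ} {K : ℕ → Ω → ℕ} {S : ℕ → Ω → Finset (Fin n)}
  {coin : ℕ → Ω → Bool} {τ : Ω → ℕ} {E : Type} [NormedAddCommGroup E] [InnerProductSpace ℝ E]
  [ProperSpace E] [MeasurableSpace E] [BorelSpace E] {G : Fin n → E → E} {L lam β : ℝ} {x₀ : E}
  {f f₁ : E → ℝ} {Δ δ fmin : ℝ}

/-- The expected squared gradient norm at the output is at most the average over the iterates. -/
theorem integral_norm_sq_output_le (hr : IsRandomness μ n m T p pB K S coin τ) (hT : 1 ≤ T)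
    (h : SimilarClients f f₁ G Δ δ L fmin) (hs : 0 < lam + L) (ha : 0 < lam - Δ) :
    Integrable (fun ω => ‖fullMean G (if τ ω ≤ T then
      (randState m G L lam β x₀ K S coin (τ ω) ω).1 else x₀)‖ ^ 2) μ ∧
    ∫ ω, ‖fullMean G (if τ ω ≤ T then
      (randState m G L lam β x₀ K S coin (τ ω) ω).1 else x₀)‖ ^ 2 ∂μ ≤
      1 / (T : ℝ) * ∑ t ∈ Finset.range T,
        ∫ ω, ‖fullMean G (randState m G L lam β x₀ K S coin (t + 1) ω).1‖ ^ 2 ∂μ := by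
  have hF := continuous_fullMean h.continuous_G
  set X : Ω → ℕ → E × E × E := fun ω j => randState m G L lam β x₀ K S coin j ω with hX
  set φ : (ℕ → E × E × E) → ℕ → ℝ := fun xs j =>
    ‖fullMean G (if j ≤ T then (xs j).1 else x₀)‖ ^ 2 with hφ
  -- The whole trajectory is determined by the draws other than `τ`, hence is independent of `τ`.
  have hXm : Measurable[sigmaOn K S coin τ {i | i ≠ Sum.inr (Sum.inr (Sum.inr ()))}] X := by
    refine @measurable_pi_lambda _ _ _ (sigmaOn K S coin τ _) _ _ fun j => ?_
    refine (measurable_randState h.continuous_G τ j).mono (sigmaOn_mono ?_) le_rfl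
    rintro i hi rfl
    exact hi
  have hXm' : Measurable X := hXm.mono (hr.sigmaOn_le _) le_rfl
  have hφm : ∀ k, Measurable fun xs => φ xs k := by
    intro k
    have hk : Measurable fun xs : ℕ → E × E × E => xs k := measurable_pi_apply k
    by_cases hkT : k ≤ T
    · simp only [hφ, hkT, if_true]
      have hc : Continuous fun s : E × E × E => ‖fullMean G s.1‖ ^ 2 := by fun_prop
      exact hc.measurable.comp hk
    · simp only [hφ, hkT, if_false]
      exact measurable_const
  have hi : ∀ j, Integrable (fun ω => ‖fullMean G (X ω j).1‖ ^ 2) μ := fun j =>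
    integrable_of_continuous hr h hs ha j j (φ := fun q => ‖fullMean G q.1.1‖ ^ 2) (by fun_prop)
  -- Domination by the sum over all candidates; the constant covers the null event `τ > T`.
  have hint : Integrable (fun ω => φ (X ω) (τ ω)) μ := by
    refine ((integrable_finsetSum (Finset.range (T + 1)) fun j _ => hi j).add
      (integrable_const (‖fullMean G x₀‖ ^ 2))).mono'
      (measurable_apply_discrete hXm' hr.measurable_τ
        (Φ := fun k xs => φ xs k) hφm).aestronglyMeasurable
      (Filter.Eventually.of_forall fun ω => ?_)
    have h0 : 0 ≤ ∑ j ∈ Finset.range (T + 1), ‖fullMean G (X ω j).1‖ ^ 2 :=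
      Finset.sum_nonneg fun _ _ => sq_nonneg _
    rw [Real.norm_of_nonneg (sq_nonneg _)]
    simp only [Pi.add_apply]
    split_ifs with hτ
    · have := Finset.single_le_sum (f := fun j => ‖fullMean G (X ω j).1‖ ^ 2)
        (fun _ _ => sq_nonneg _) (Finset.mem_range_succ_iff.2 hτ)
      have h1 := sq_nonneg ‖fullMean G x₀‖
      linarith
    · linarith
  refine ⟨hint, ?_⟩
  have key := integral_le_integral_of_indep hXm' hr.measurable_τ
    (hr.indep_comap hXm (j := Sum.inr (Sum.inr (Sum.inr ()))) (fun hne => hne rfl))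
    hφm hint (ψ := fun xs => ∑ t ∈ Finset.range T, 1 / (T : ℝ) * ‖fullMean G (xs (t + 1)).1‖ ^ 2)
    (integrable_finsetSum _ fun t _ => (hi (t + 1)).const_mul _)
    (fun xs => by
      have hu := integral_uniform hr.measurable_τ (s := Finset.Icc 1 T)
        (Finset.nonempty_Icc.2 hT) (fun k hk => by simpa using hr.law_τ k hk) (φ xs)
      rw [hu, Nat.card_Icc, Nat.add_sub_cancel, Finset.range_eq_Ico,
        Finset.sum_Ico_add' (fun j => 1 / (T : ℝ) * ‖fullMean G (xs j).1‖ ^ 2) 0 T 1]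
      refine (Finset.sum_congr (by ext; simp) fun j hj => ?_).le
      simp only [hφ]
      rw [if_pos (by simp at hj; omega)])
  refine key.trans_eq ?_
  rw [integral_finsetSum _ fun t _ => (hi (t + 1)).const_mul _, Finset.mul_sum]
  exact Finset.sum_congr rfl fun t _ => integral_const_mul _ _

end Output

/-! ### Expected costs -/

section Costs

variable {Ω : Type*} {mΩ : MeasurableSpace Ω} {μ : Measure Ω} [IsProbabilityMeasure μ]
  {n m T : ℕ} {p pB : ℝ} {K : ℕ → Ω → ℕ} {S : ℕ → Ω → Finset (Fin n)}
  {coin : ℕ → Ω → Bool} {τ : Ω → ℕ}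

theorem integral_coin (hr : IsRandomness μ n m T p pB K S coin τ) (hpB : 0 ≤ pB) (t : ℕ) (c : ℝ) :
    Integrable (fun ω => if coin t ω then c else 0) μ ∧
      ∫ ω, (if coin t ω then c else 0) ∂μ = pB * c := by
  refine ⟨integrable_comp_of_bounded (b := fun x : Bool => if x then c else 0) (B := |c|)
    (hr.measurable_coin t) fun x => by cases x <;> simp, ?_⟩
  rw [integral_bernoulli hpB (hr.measurable_coin t) (hr.law_coin t)
    (fun x : Bool => if x then c else 0)]
  simp

theorem integral_communicationCost (hr : IsRandomness μ n m T p pB K S coin τ) (hpB : 0 ≤ pB)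
    (a b : ℝ) :
    Integrable (fun ω => communicationCost a b (syncRounds n m ⌈(n : ℝ) / m⌉₊ ++
      loopRounds n m (fun t => K t ω) (fun t => S t ω) (fun t => coin t ω) T 0)) μ ∧
    ∫ ω, communicationCost a b (syncRounds n m ⌈(n : ℝ) / m⌉₊ ++
      loopRounds n m (fun t => K t ω) (fun t => S t ω) (fun t => coin t ω) T 0) ∂μ =
      a * ⌈(n : ℝ) / m⌉₊ + T * (b + 1 + pB * (a * ⌈(n : ℝ) / m⌉₊)) := by
  simp only [communicationCost_append, communicationCost_syncRounds,
    communicationCost_loopRounds, mul_ite, mul_one, mul_zero, zero_add]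
  have hc := fun t => integral_coin hr hpB t (a * ⌈(n : ℝ) / m⌉₊)
  have hi : ∀ t, Integrable (fun ω => b + 1 +
      if coin t ω then a * (⌈(n : ℝ) / m⌉₊ : ℝ) else 0) μ := fun t =>
    (integrable_const _).add (hc t).1
  have hsum := integrable_finsetSum (Finset.range T) fun j _ => hi (j + 1)
  refine ⟨(integrable_const _).add hsum, ?_⟩
  rw [integral_add (integrable_const _) hsum, integral_finsetSum _ fun j _ => hi (j + 1),
    Finset.sum_congr rfl fun j _ => (integral_add (integrable_const _) (hc (j + 1)).1).trans
      (congrArg _ (hc (j + 1)).2)]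
  simp
  ring

theorem integral_localCost_le (hr : IsRandomness μ n m T p pB K S coin τ) (hpB : 0 ≤ pB)
    (hp : 0 < p) (hp1 : p < 1) :
    Integrable (fun ω => (localCost (syncRounds n m ⌈(n : ℝ) / m⌉₊ ++
      loopRounds n m (fun t => K t ω) (fun t => S t ω) (fun t => coin t ω) T 0) : ℝ)) μ ∧
    ∫ ω, (localCost (syncRounds n m ⌈(n : ℝ) / m⌉₊ ++
      loopRounds n m (fun t => K t ω) (fun t => S t ω) (fun t => coin t ω) T 0) : ℝ) ∂μ ≤
      ⌈(n : ℝ) / m⌉₊ + T * (1 / p + 3 + pB * ⌈(n : ℝ) / m⌉₊) := by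
  have hN : (localCost (syncRounds n m ⌈(n : ℝ) / m⌉₊) : ℝ) ≤ ⌈(n : ℝ) / m⌉₊ := by
    exact_mod_cast localCost_syncRounds_le n m _
  set c : ℝ := (localCost (syncRounds n m ⌈(n : ℝ) / m⌉₊) : ℝ)
  have hS3 : ∀ C : Finset (Fin n), ((C.sup fun _ => 3 : ℕ) : ℝ) ≤ 3 := fun C => by
    exact_mod_cast Finset.sup_le fun _ _ => le_rfl
  have e : ∀ ω, (localCost (syncRounds n m ⌈(n : ℝ) / m⌉₊ ++
      loopRounds n m (fun t => K t ω) (fun t => S t ω) (fun t => coin t ω) T 0) : ℝ) =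
      c + ∑ j ∈ Finset.range T, ((K j ω : ℝ) + 1 + (((S j ω).sup fun _ => 3 : ℕ) : ℝ) +
        if coin (j + 1) ω then c else 0) := by
    intro ω
    rw [localCost_append, localCost_loopRounds]
    push_cast
    simp only [zero_add]
    rfl
  simp only [e]
  have hc := fun t => integral_coin hr hpB t c
  have hK := fun t => integral_geometric hp hp1 (hr.measurable_K t) (hr.law_K t)
  have hS : ∀ t, Integrable (fun ω => (((S t ω).sup fun _ => 3 : ℕ) : ℝ)) μ := fun t =>
    integrable_comp_of_bounded (b := fun C : Finset (Fin n) => ((C.sup fun _ => 3 : ℕ) : ℝ))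
      (hr.measurable_S t) fun C => by rw [Nat.abs_cast]; exact hS3 C
  have hi1 : ∀ t, Integrable (fun ω => (K t ω : ℝ) + 1) μ := fun t =>
    (hK t).1.add (integrable_const _)
  have hi2 : ∀ t, Integrable
      (fun ω => (K t ω : ℝ) + 1 + (((S t ω).sup fun _ => 3 : ℕ) : ℝ)) μ := fun t =>
    (hi1 t).add (hS t)
  have hi : ∀ t, Integrable (fun ω => (K t ω : ℝ) + 1 + (((S t ω).sup fun _ => 3 : ℕ) : ℝ) +
      if coin (t + 1) ω then c else 0) μ := fun t => (hi2 t).add (hc (t + 1)).1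
  have hsum := integrable_finsetSum (Finset.range T) fun j _ => hi j
  refine ⟨(integrable_const _).add hsum, ?_⟩
  rw [integral_add (integrable_const _) hsum, integral_finsetSum _ fun j _ => hi j,
    integral_const, probReal_univ, one_smul]
  have hterm : ∀ t ∈ Finset.range T, ∫ ω, ((K t ω : ℝ) + 1 + (((S t ω).sup fun _ => 3 : ℕ) : ℝ) +
      if coin (t + 1) ω then c else 0) ∂μ ≤ 1 / p + 3 + pB * ⌈(n : ℝ) / m⌉₊ := by
    intro t _
    rw [integral_add (hi2 t) (hc (t + 1)).1, integral_add (hi1 t) (hS t),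
      integral_add (hK t).1 (integrable_const _), (hK t).2, (hc (t + 1)).2, integral_const,
      probReal_univ, one_smul]
    have h3 : ∫ ω, (((S t ω).sup fun _ => 3 : ℕ) : ℝ) ∂μ ≤ ∫ _, (3 : ℝ) ∂μ :=
      integral_mono (hS t) (integrable_const _) fun ω => hS3 _
    rw [integral_const, probReal_univ, one_smul] at h3
    have := mul_le_mul_of_nonneg_left hN hpB
    linarith
  have := Finset.sum_le_sum hterm
  rw [Finset.sum_const, Finset.card_range, nsmul_eq_mul] at this
  linarith

end Costs

/-! ### From the stated hypotheses to `SimilarClients` -/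

section Problem

variable {d n : ℕ} [NeZero n] {f : Fin n → EuclideanSpace ℝ (Fin d) → ℝ}

theorem hasGradientAt_objective {d n : ℕ} {f : Fin n → EuclideanSpace ℝ (Fin d) → ℝ}
    (hf : ∀ i, Differentiable ℝ (f i))
    (x : EuclideanSpace ℝ (Fin d)) :
    HasGradientAt (objective f) (fullMean (fun i => gradient (f i)) x) x := by
  rw [hasGradientAt_iff_hasFDerivAt, fullMean, map_smul, map_sum]
  have h : HasFDerivAt (fun z => ∑ i, f i z) (∑ i, fderiv ℝ (f i) x) x :=
    HasFDerivAt.fun_sum fun i _ => (hf i x).hasFDerivAt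
  simp only [toDual_gradient]
  exact h.const_mul (1 / (n : ℝ))

theorem gradient_difference {d n : ℕ} {f : Fin n → EuclideanSpace ℝ (Fin d) → ℝ}
    (hf : ∀ i, Differentiable ℝ (f i)) (i : Fin n)
    (x : EuclideanSpace ℝ (Fin d)) :
    gradient (difference f i) x =
      fullMean (fun i => gradient (f i)) x - gradient (f i) x :=
  ((hasGradientAt_objective hf x).sub' (hf i x).hasGradientAt).gradient

theorem continuous_of_norm_sub_le {E E' : Type*} [SeminormedAddCommGroup E]
    [SeminormedAddCommGroup E'] {g : E → E'} {c : ℝ} (h : ∀ x y, ‖g x - g y‖ ≤ c * ‖x - y‖) :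
    Continuous g :=
  (LipschitzWith.of_dist_le' (K := c) fun x y => by
    rw [dist_eq_norm, dist_eq_norm]; exact h x y).continuous

/-- Only client 0 is assumed to have a Lipschitz gradient, yet all gradients are continuous: each
∇hᵢ is √n·δ-Lipschitz as one summand of the averaged bound, ∇f = ∇h₀ + ∇f₀, and ∇fᵢ = ∇f − ∇hᵢ. -/
theorem similarClients (hf : ∀ i, Differentiable ℝ (f i))
    (hbdd : BddBelow (Set.range (objective f))) {Δ δ L : ℝ} (hδ : 0 < δ)
    (hED : ∀ x y, ‖gradient (difference f 0) x - gradient (difference f 0) y‖ ≤ Δ * ‖x - y‖)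
    (hSOD : ∀ x y, (1 / (n : ℝ)) *
      ∑ i, ‖gradient (difference f i) x - gradient (difference f i) y‖ ^ 2 ≤ δ ^ 2 * ‖x - y‖ ^ 2)
    (hL : ∀ x y, ‖gradient (f 0) x - gradient (f 0) y‖ ≤ L * ‖x - y‖) :
    SimilarClients (objective f) (f 0) (fun i => gradient (f i)) Δ δ L (⨅ x, objective f x) := by
  have hobj : Differentiable ℝ (objective f) := fun x =>
    (hasGradientAt_objective hf x).differentiableAt
  have hdiff : Differentiable ℝ (difference f 0) := hobj.sub (hf 0)
  have hn : (0 : ℝ) < n := by exact_mod_cast Nat.pos_of_ne_zero (NeZero.ne n)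
  have hdc : ∀ i, Continuous (gradient (difference f i)) := by
    intro i
    refine continuous_of_norm_sub_le (c := √n * δ) fun x y => ?_
    refine abs_le_of_sq_le_sq' ?_ (by positivity) |>.2
    have h1 := Finset.single_le_sum
      (f := fun i => ‖gradient (difference f i) x - gradient (difference f i) y‖ ^ 2)
      (fun _ _ => sq_nonneg _) (Finset.mem_univ i)
    have h2 := hSOD x y
    rw [one_div_mul_eq_div, div_le_iff₀ hn] at h2
    rw [mul_pow, mul_pow, Real.sq_sqrt hn.le]
    calc _ ≤ _ := h1
      _ ≤ _ := h2
      _ = _ := by ring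
  have hc0 : Continuous (gradient (f 0)) := continuous_of_norm_sub_le hL
  have hcF : Continuous (fullMean fun i => gradient (f i)) := by
    have := (hdc 0).add hc0
    refine this.congr fun x => ?_
    rw [Pi.add_apply, gradient_difference hf, sub_add_cancel]
  have hdesc := le_quadratic_of_lipschitz_gradient hdiff hED
  simp only [gradient_difference hf] at hED hSOD hdesc
  exact
    { continuous_f := hobj.continuous
      continuous_f₁ := (hf 0).continuous
      continuous_G := fun i => by
        refine (hcF.sub (hdc i)).congr fun x => ?_
        rw [Pi.sub_apply, gradient_difference hf, sub_sub_cancel]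
      lipschitz := hL
      similarity₁ := hED
      similarity := hSOD
      descent₁ := le_quadratic_of_lipschitz_gradient (hf 0) hL
      descent := hdesc
      le_f := fun x => ciInf_le hbdd x }

end Problem

end

end FedOpt

/-! ### Accuracy and complexity with the chosen parameters -/

theorem mainTheorem8 {d n m : ℕ} [NeZero n] (hm : 1 ≤ m) (hmn : m ≤ n)
    (f : Fin n → EuclideanSpace ℝ (Fin d) → ℝ)
    (hf : ∀ i, Differentiable ℝ (f i))
    (hbdd : BddBelow (Set.range (objective f)))
    (Δ₁ δ L₁ : ℝ) (hΔ₁ : 0 < Δ₁) (hδ : 0 < δ) (hL₁ : 0 < L₁)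
    (hED : ∀ x y, ‖gradient (difference f 0) x - gradient (difference f 0) y‖ ≤ Δ₁ * ‖x - y‖)
    (hSOD : ∀ x y, (1 / (n : ℝ)) *
      ∑ i, ‖gradient (difference f i) x - gradient (difference f i) y‖ ^ 2 ≤ δ ^ 2 * ‖x - y‖ ^ 2)
    (hL : ∀ x y, ‖gradient (f 0) x - gradient (f 0) y‖ ≤ L₁ * ‖x - y‖)
    (x₀ : EuclideanSpace ℝ (Fin d)) (hF : 0 < initialGap f x₀)
    (ε : ℝ) (hε : 0 < ε)
    (pB lam β p : ℝ) (hpB : 0 < pB) (hpB1 : pB ≤ 1)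
    (hlam : lam = 3 * Δ₁ + 22 * deltaM n m δ / Real.sqrt pB)
    (hβ : β = pB / 2)
    (hp : p = (lam - Δ₁) / (8 * (L₁ + lam)))
    (T : ℕ)
    (hT : T = ⌈256 * (Δ₁ + 8 * deltaM n m δ / Real.sqrt pB) * initialGap f x₀ / ε ^ 2⌉₊)
    {Ω : Type*} [MeasurableSpace Ω] (μ : Measure Ω) [IsProbabilityMeasure μ]
    (K : ℕ → Ω → ℕ) (S : ℕ → Ω → Finset (Fin n)) (coin : ℕ → Ω → Bool) (τ : Ω → ℕ)
    (hrand : IsRandomness μ n m T p pB K S coin τ)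
    (alg : Ω → FedAlgorithm n m (EuclideanSpace ℝ (Fin d)) (EuclideanSpace ℝ (Fin d)))
    (halg : ∀ ω, alg ω =
      icgmRgSvrg n m L₁ lam β T x₀ (fun t => K t ω) (fun t => coin t ω) (τ ω))
    (xbar : Ω → EuclideanSpace ℝ (Fin d))
    (hxbar : ∀ ω, xbar ω = (alg ω).output (firstOrderOracle f) (fun t => S t ω))
    (rounds : Ω → List Round)
    (hrounds : ∀ ω, rounds ω = (alg ω).rounds (firstOrderOracle f) (fun t => S t ω)) :
    (Integrable (fun ω => ‖gradient (objective f) (xbar ω)‖ ^ 2) μ ∧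
      ∫ ω, ‖gradient (objective f) (xbar ω)‖ ^ 2 ∂μ ≤ ε ^ 2) ∧
    ∀ C_A C_R : ℝ, 1 ≤ C_R → C_R ≤ C_A → pB = C_R / (C_A * ⌈(n : ℝ) / m⌉₊) →
      (Integrable (fun ω => communicationCost C_A C_R (rounds ω)) μ ∧
        ∫ ω, communicationCost C_A C_R (rounds ω) ∂μ ≤
          C_A * ⌈(n : ℝ) / m⌉₊ + (2 * C_R + 1) *
            ⌈256 * (Δ₁ + 8 * deltaM n m δ * Real.sqrt (C_A * ⌈(n : ℝ) / m⌉₊ / C_R)) *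
              initialGap f x₀ / ε ^ 2⌉₊) ∧
      (Integrable (fun ω => (localCost (rounds ω) : ℝ)) μ ∧
        ∫ ω, (localCost (rounds ω) : ℝ) ∂μ ≤
          16 + ⌈(n : ℝ) / m⌉₊ +
            1024 * (L₁ + 4 * Δ₁ + 33 * Real.sqrt (C_A * ⌈(n : ℝ) / m⌉₊ / C_R) * deltaM n m δ) *
              initialGap f x₀ / ε ^ 2 +
            4 * L₁ / (Δ₁ + 11 * Real.sqrt (C_A * ⌈(n : ℝ) / m⌉₊ / C_R) * deltaM n m δ)) := by
  have hsim := similarClients hf hbdd hδ hED hSOD hL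
  obtain ⟨D, hD⟩ : ∃ D, D = deltaM n m δ / √pB := ⟨_, rfl⟩
  have hD0 : 0 ≤ D := by
    rw [hD]
    exact div_nonneg (mul_nonneg (Real.sqrt_nonneg _) hδ.le) (Real.sqrt_nonneg _)
  rw [mul_div_assoc, ← hD] at hlam
  rw [mul_div_assoc (8 : ℝ), ← hD] at hT
  have hab : lam - Δ₁ = 2 * Δ₁ + 22 * D := by rw [hlam]; ring
  have ha : 0 < lam - Δ₁ := by rw [hab]; positivity
  have hlam0 : 0 < lam := by linarith
  have hp0 : 0 < p := by rw [hp]; positivity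
  have hp1 : p < 1 := by
    rw [hp, div_lt_one (by positivity)]
    linarith
  have hTpos : 1 ≤ T := by
    rw [hT, Nat.one_le_iff_ne_zero]
    exact (Nat.ceil_pos.2 (by positivity)).ne'
  have hTle : 256 * (Δ₁ + 8 * D) * initialGap f x₀ / ε ^ 2 ≤ T := by
    rw [hT]
    exact Nat.le_ceil _
  have hgrad : gradient (objective f) = fullMean fun i => gradient (f i) := by
    ext1 x
    exact (hasGradientAt_objective hf x).gradient
  have hxbar' : ∀ ω, xbar ω = if τ ω ≤ T then
      (randState m (fun i => gradient (f i)) L₁ lam β x₀ K S coin (τ ω) ω).1 else x₀ := by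
    intro ω
    rw [hxbar, halg]
    exact output_icgmRgSvrg (firstOrderOracle f) L₁ lam β x₀ _ _ _ _ hm T _ rfl
  have hrounds' : ∀ ω, rounds ω = syncRounds n m ⌈(n : ℝ) / m⌉₊ ++
      loopRounds n m (fun t => K t ω) (fun t => S t ω) (fun t => coin t ω) T 0 := by
    intro ω
    rw [hrounds, halg, rounds_icgmRgSvrg (firstOrderOracle f) L₁ lam β x₀ _ _ _ _ hm T]
  simp only [hgrad, hxbar', hrounds']
  refine ⟨?_, fun C_A C_R hCR hCA hpBC => ?_⟩
  · have hout := integral_norm_sq_output_le (β := β) (x₀ := x₀) hrand hTpos hsim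
      (by linarith : 0 < lam + L₁) ha
    refine ⟨hout.1, hout.2.trans ?_⟩
    have hsum := sum_integral_norm_sq_le (x₀ := x₀) hrand hsim hm hmn hΔ₁.le hL₁
      (by linarith) ha hp hpB hpB1 hβ (by
        have : 484 * deltaM n m δ ^ 2 / pB = 484 * D ^ 2 := by
          rw [hD, div_pow, Real.sq_sqrt hpB.le]
          ring
        rw [this, hab]
        nlinarith [mul_nonneg hΔ₁.le hD0, sq_nonneg Δ₁]) T
    rw [one_div_mul_eq_div, div_le_iff₀ (by exact_mod_cast hTpos)]
    refine hsum.trans ?_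
    rw [div_le_iff₀ (by positivity)] at hTle
    rw [mul_comm (ε ^ 2)]
    refine le_trans ?_ hTle
    change 64 * (lam - Δ₁) * initialGap f x₀ ≤ _
    -- Here 64(2Δ₁ + 22D) = 128Δ₁ + 1408D, below 256Δ₁ + 2048D.
    refine mul_le_mul_of_nonneg_right ?_ hF.le
    rw [hab]
    linarith
  · have hCR0 : 0 < C_R := by linarith
    have hCA0 : 0 < C_A := by linarith
    have hN : (1 : ℝ) ≤ ⌈(n : ℝ) / m⌉₊ := by
      have hmR : (0 : ℝ) < m := by exact_mod_cast hm
      have hnm : (m : ℝ) ≤ n := by exact_mod_cast hmn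
      exact ((one_le_div hmR).2 hnm).trans (Nat.le_ceil _)
    have hN0 : (0 : ℝ) < ⌈(n : ℝ) / m⌉₊ := by linarith
    have hsqrt : √(C_A * ⌈(n : ℝ) / m⌉₊ / C_R) = 1 / √pB := by
      rw [hpBC, one_div, ← Real.sqrt_inv, inv_div]
    have hDs : deltaM n m δ * √(C_A * ⌈(n : ℝ) / m⌉₊ / C_R) = D := by
      rw [hsqrt, hD, mul_one_div]
    -- The choice of `pB` makes the expected synchronization cost of an iteration equal to that of
    -- its random round.
    have hpBN : pB * (C_A * ⌈(n : ℝ) / m⌉₊) = C_R := by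
      rw [hpBC]
      field_simp
    rw [mul_assoc 8, mul_assoc 33, mul_assoc 11, mul_comm (√_) (deltaM n m δ), hDs, ← hT]
    refine ⟨?_, ?_⟩
    · have h := integral_communicationCost hrand hpB.le C_A C_R
      refine ⟨h.1, h.2.le.trans_eq ?_⟩
      rw [hpBN]
      ring
    · have h := integral_localCost_le hrand hpB.le hp0 hp1
      refine ⟨h.1, h.2.trans ?_⟩
      have hpBN1 : pB * ⌈(n : ℝ) / m⌉₊ ≤ 1 := by
        have : pB * ⌈(n : ℝ) / m⌉₊ = C_R / C_A := by
          rw [hpBC]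
          field_simp
        rw [this, div_le_one hCA0]
        exact hCA
      have hb : 0 < Δ₁ + 11 * D := by positivity
      -- The 4 consists of the 3 queries of the random round and at most 1 expected query for
      -- synchronization.
      have hq : 1 / p + 4 = 4 * (L₁ + 4 * Δ₁ + 33 * D) / (Δ₁ + 11 * D) := by
        rw [hp, hab, hlam]
        field_simp
        ring
      have hT1 : (T : ℝ) ≤ 256 * (Δ₁ + 8 * D) * initialGap f x₀ / ε ^ 2 + 1 := by
        rw [hT]
        exact (Nat.ceil_lt_add_one (by positivity)).le
      -- Weakening 8 to 11 lets this factor cancel the denominator in `hq`.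
      have hT2 : 256 * (Δ₁ + 8 * D) * initialGap f x₀ / ε ^ 2 ≤
          256 * (Δ₁ + 11 * D) * initialGap f x₀ / ε ^ 2 := by
        gcongr
        norm_num
      calc (⌈(n : ℝ) / m⌉₊ : ℝ) + T * (1 / p + 3 + pB * ⌈(n : ℝ) / m⌉₊)
          ≤ ⌈(n : ℝ) / m⌉₊ + T * (1 / p + 4) := by
            refine add_le_add_right (mul_le_mul_of_nonneg_left ?_ T.cast_nonneg) _
            linarith
        _ ≤ ⌈(n : ℝ) / m⌉₊ + (256 * (Δ₁ + 11 * D) * initialGap f x₀ / ε ^ 2 + 1) *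
              (4 * (L₁ + 4 * Δ₁ + 33 * D) / (Δ₁ + 11 * D)) := by
            rw [hq]
            gcongr
            linarith
        _ = ⌈(n : ℝ) / m⌉₊ + 1024 * (L₁ + 4 * Δ₁ + 33 * D) * initialGap f x₀ / ε ^ 2 +
              4 * L₁ / (Δ₁ + 11 * D) + (16 * Δ₁ + 132 * D) / (Δ₁ + 11 * D) := by
            field_simp
            ring
        _ ≤ _ := by
            -- The 1 lost to the ceiling in `T` produces both this quotient and the term with 4L₁;
            -- this quotient is the source of the additive 16.
            have : (16 * Δ₁ + 132 * D) / (Δ₁ + 11 * D) ≤ 16 := by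
              rw [div_le_iff₀ hb]
              linarith
            linarith
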